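/- Let $\alpha,\beta>-1$, $N\ge 0$, let $c_1,\dots,c_N\in\mathbb R\setminus(-1,1)$ be distinct, $d_1,\dots,d_N\in\mathbb Z_{\ge0}$, and $\lambda_{j,k}\ge 0$ ($1\le j\le N$, $0\le k\le d_j$) with $\lambda_{j,d_j}>0$. Put $\langle f,g\rangle_\mu=\int_{-1}^1 f(x)g(x)(1-x)^\alpha(1+x)^\beta\,dx$ and $$\langle f,g\rangle_{\mathsf s}=\langle f,g\rangle_\mu+\sum_{j=1}^N\sum_{k=0}^{d_j}\lambda_{j,k}f^{(k)}(c_j)g^{(k)}(c_j).$$ Let $S_n$ (the $n$-th Jacobi–Sobolev polynomial) be the monic polynomial of lowest degree with $\langle x^k,S_n\rangle_{\mathsf s}=0$ for $0\le k<n$, let $P_n$ be the monic Jacobi polynomial (defined in the same way from $\langle\cdot,\cdot\rangle_\mu$), $h_n=\langle P_n,P_n\rangle_\mu$, $\gamma_{1,n}=\langle P_n,xP_n\rangle_\mu/h_n$, and $\gamma_{2,n}=h_n/h_{n-1}$ for $n\ge1$. Let $$\hat a_n=-\tfrac{n((2n+\alpha+\beta)x+\beta-\alpha)}{2n+\alpha+\beta},\quad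 \hat b_n=\tfrac{4n(n+\alpha)(n+\beta)(n+\alpha+\beta)}{(2n+\alpha+\beta)^2(2n+\alpha+\beta-1)},\quad \hat c_n=\tfrac{(n+\alpha+\beta)((2n+\alpha+\beta)x+\alpha-\beta)}{2n+\alpha+\beta},\quad \hat d_n=-(2n+\alpha+\beta-1),$$ where $\hat a_0=0$, $\hat b_0=0$, and common factors are cancelled in $\hat b_1=\frac{4(1+\alpha)(1+\beta)}{(2+\alpha+\beta)^2}$ and $\hat c_0=(\alpha+\beta)x+\alpha-\beta$. Let $\rho=\prod_{j}(x-c_j)^{d_j+1}$, $\rho_{j,k}=\rho/(x-c_j)^{k+1}$, $Q_k(x,y;f)=\sum_{\nu=0}^k\frac{f^{(\nu)}(y)}{\nu!}(x-y)^\nu$ and $M_n[f]=\sum_{j,k}k!\,\lambda_{j,k}S_n^{(k)}(c_j)\,Q_k(x,c_j;f)\,\rho_{j,k}(x)$. For $n\ge1$ let $$A_{2,n}=\rho-\frac{M_n[P_{n-1}]}{h_{n-1}},\qquad B_{2,n}=\frac{M_n[P_n]}{h_{n-1}},$$ and let $A_{2,0}=\rho$, $B_{2,0}=0$. For $n\ge0$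 let $$A_{3,n}=(1-x^2)A_{2,n}'+\hat a_nA_{2,n}+\hat d_nB_{2,n},\qquad B_{3,n}=(1-x^2)B_{2,n}'+\hat b_nA_{2,n}+\hat c_nB_{2,n}.$$ For $n\ge2$ let $C_{i,n}=-B_{i,n-1}/\gamma_{2,n-1}$ ($i=2,3$). For $n=1$, where this quotient reads $0/0$ (the three-term recurrence has no $P_{-1}$-term, $\gamma_{2,0}=0$), let $C_{2,1}=-M_0[P_0]/h_0$ and $C_{3,1}=(1-x^2)C_{2,1}'-(\alpha+\beta+1)A_{2,0}+\hat c_0C_{2,1}$ (for $n\ge 2$ one likewise has $C_{2,n}=-M_{n-1}[P_{n-1}]/h_{n-1}$ and $C_{3,n}=(1-x^2)C_{2,n}'-(2n+\alpha+\beta-1)A_{2,n-1}+\hat c_{n-1}C_{2,n}$). For $n\ge1$ let $D_{i,n}=A_{i,n-1}-C_{i,n}\,(x-\gamma_{1,n-1})$ ($i=2,3$), $\Delta_n=A_{2,n}D_{2,n}-B_{2,n}C_{2,n}$, $\delta_n=\Delta_n/\rho$, $$q_{0,n}=(1-x^2)\Delta_n,\qquad q_{3,n}=(1-x^2)\rho'\delta_n+C_{3,n}B_{2,n}-D_{3,n}A_{2,n},\qquad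 q_{4,n}=C_{3,n}D_{2,n}-D_{3,n}C_{2,n},$$ and let the raising Jacobi–Sobolev operator, acting on rational functions, be $$\mathfrak L_n^{\uparrow}=\frac{q_{3,n}}{q_{4,n}}\,\mathfrak I+\frac{q_{0,n}}{q_{4,n}}\,\frac{d}{dx}.$$ Assume that $\alpha+\beta\ne-1$ or that $\lambda_{j,0}>0$ for at least one $j$. Then $S_0=1$ and, for every $n\ge0$, $$S_n=\mathfrak L_n^{\uparrow}\,\mathfrak L_{n-1}^{\uparrow}\cdots\mathfrak L_1^{\uparrow}\,S_0 .$$ -/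

import Mathlib

open scoped Polynomial

noncomputable section

namespace JacobiSobolev

open Polynomial

/-- `p` is a monic polynomial of lowest possible degree with `B (X ^ k) p = 0` for all `k < n`. -/
def IsMonicOrth (B : ℝ[X] → ℝ[X] → ℝ) (n : ℕ) (p : ℝ[X]) : Prop :=
  p.Monic ∧ (∀ k < n, B (X ^ k) p = 0) ∧
    ∀ q : ℝ[X], q.Monic → (∀ k < n, B (X ^ k) q = 0) → p.natDegree ≤ q.natDegree

/-- The `n`-th monic orthogonal polynomial with respect to `B`. -/
def monicOrth (B : ℝ[X] → ℝ[X] → ℝ) (n : ℕ) : ℝ[X] :=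
  Classical.epsilon (IsMonicOrth B n)

/-- The derivative of a rational function, by the quotient rule. -/
def ratDeriv (f : RatFunc ℝ) : RatFunc ℝ :=
  algebraMap ℝ[X] (RatFunc ℝ) (derivative f.num * f.denom - f.num * derivative f.denom) /
    algebraMap ℝ[X] (RatFunc ℝ) (f.denom ^ 2)

/-- `taylorPoly k y f` is the Taylor polynomial of degree `k` of `f` centered at `y`, that is
`∑_{ν ≤ k} f^{(ν)}(y) / ν! * (x - y) ^ ν`, as a polynomial in `x`. -/
def taylorPoly (k : ℕ) (y : ℝ) (f : ℝ[X]) : ℝ[X] :=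
  ∑ ν ∈ Finset.range (k + 1),
    C ((derivative^[ν] f).eval y / (Nat.factorial ν : ℝ)) * (X - C y) ^ ν

/-- The parameters of a Jacobi-Sobolev inner product: the exponents `α`, `β` of the weight
`(1 - x) ^ α * (1 + x) ^ β`, the mass points `c j`, the orders `d j`, and the masses
`lam j k` for `k ≤ d j` (values `lam j k` with `k > d j` are never used). -/
structure Data where
  α : ℝ
  β : ℝ
  N : ℕ
  c : Fin N → ℝ
  d : Fin N → ℕ
  lam : Fin N → ℕ → ℝ

namespace Data

variable (D : Data)

/-- The Jacobi inner product. -/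
def ipJacobi (f g : ℝ[X]) : ℝ :=
  ∫ x in (-1 : ℝ)..1, f.eval x * g.eval x * ((1 - x) ^ D.α * (1 + x) ^ D.β)

/-- The Jacobi-Sobolev inner product. -/
def ipSobolev (f g : ℝ[X]) : ℝ :=
  D.ipJacobi f g + ∑ j : Fin D.N, ∑ k ∈ Finset.range (D.d j + 1),
    D.lam j k * (derivative^[k] f).eval (D.c j) * (derivative^[k] g).eval (D.c j)

/-- The monic Jacobi polynomials. -/
def P (n : ℕ) : ℝ[X] := monicOrth D.ipJacobi n

/-- The monic Jacobi-Sobolev polynomials. -/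
def S (n : ℕ) : ℝ[X] := monicOrth D.ipSobolev n

/-- The squared norm of the monic Jacobi polynomial. -/
def h (n : ℕ) : ℝ := D.ipJacobi (D.P n) (D.P n)

/-- The coefficients of the three-term recurrence
`x P_n = P_{n+1} + γ₁ n * P_n + γ₂ n * P_{n-1}` (`γ₂` is used for `n ≥ 1` only). -/
def γ₁ (n : ℕ) : ℝ := D.ipJacobi (D.P n) (X * D.P n) / D.h n

def γ₂ (n : ℕ) : ℝ := D.h n / D.h (n - 1)

/-- The coefficients of `(1 - x²) P_n' = aHat P_n + bHat P_{n-1}` and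
`(1 - x²) P_{n-1}' = cHat P_{n-1} + dHat P_n`. -/
def aHat (n : ℕ) : ℝ[X] :=
  -C ((n : ℝ) / (2 * n + D.α + D.β)) * (C (2 * n + D.α + D.β) * X + C (D.β - D.α))

/-- For `n = 1` the factor `α + β + 1` common to the numerator and the denominator of the general
expression is cancelled. -/
def bHat : ℕ → ℝ
  | 0 => 0
  | 1 => 4 * (1 + D.α) * (1 + D.β) / (2 + D.α + D.β) ^ 2
  | n => 4 * n * (n + D.α) * (n + D.β) * (n + D.α + D.β) /
      ((2 * n + D.α + D.β) ^ 2 * (2 * n + D.α + D.β - 1))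

/-- For `n = 0` the factor `α + β` common to the numerator and the denominator of the general
expression is cancelled. -/
def cHat : ℕ → ℝ[X]
  | 0 => C (D.α + D.β) * X + C (D.α - D.β)
  | n => C ((n + D.α + D.β) / (2 * n + D.α + D.β)) *
      (C (2 * n + D.α + D.β) * X + C (D.α - D.β))

def dHat (n : ℕ) : ℝ := -(2 * n + D.α + D.β - 1)

/-- `ρ = ∏ j, (x - c_j) ^ (d_j + 1)`. -/
def ρ : ℝ[X] := ∏ j : Fin D.N, (X - C (D.c j)) ^ (D.d j + 1)

/-- `ρ_{j,k} = ρ / (x - c_j) ^ (k + 1)` for `k ≤ d_j`. -/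
def ρpart (j : Fin D.N) (k : ℕ) : ℝ[X] :=
  (X - C (D.c j)) ^ (D.d j - k) *
    ∏ i ∈ Finset.univ.erase j, (X - C (D.c i)) ^ (D.d i + 1)

/-- `∑_{j,k} k! λ_{j,k} S_n^{(k)}(c_j) Q_k(x, c_j; f) ρ_{j,k}`; terms with `λ_{j,k} = 0` vanish,
so this is the sum over the pairs with `λ_{j,k} > 0`. -/
def massSum (n : ℕ) (f : ℝ[X]) : ℝ[X] :=
  ∑ j : Fin D.N, ∑ k ∈ Finset.range (D.d j + 1),
    C ((Nat.factorial k : ℝ) * D.lam j k * (derivative^[k] (D.S n)).eval (D.c j)) *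
      taylorPoly k (D.c j) f * D.ρpart j k

/-- `ρ S_n = A₂ P_n + B₂ P_{n-1}`, where `P_{-1} = 0`, `A₂ = ρ` and `B₂ = 0` if `n = 0`. -/
def A₂ : ℕ → ℝ[X]
  | 0 => D.ρ
  | n + 1 => D.ρ - C (1 / D.h n) * D.massSum (n + 1) (D.P n)

def B₂ : ℕ → ℝ[X]
  | 0 => 0
  | n + 1 => C (1 / D.h n) * D.massSum (n + 1) (D.P (n + 1))

/-- `(1 - x²) (ρ S_n)' = A₃ P_n + B₃ P_{n-1}`. -/
def A₃ (n : ℕ) : ℝ[X] :=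
  derivative (D.A₂ n) * (1 - X ^ 2) + D.aHat n * D.A₂ n + C (D.dHat n) * D.B₂ n

def B₃ (n : ℕ) : ℝ[X] :=
  derivative (D.B₂ n) * (1 - X ^ 2) + C (D.bHat n) * D.A₂ n + D.cHat n * D.B₂ n

/-- `ρ S_{n-1} = C₂ P_n + D₂ P_{n-1}`, for `n ≥ 1`. In general `C₂ n = -B₂ (n-1) / γ₂ (n-1)`,
which equals `-(1 / h (n-1)) * massSum (n-1) (P (n-1))` because `γ₂ (n-1) * h (n-2) = h (n-1)`.
For `n = 1` the quotient reads `0 / 0`, and the second expression is taken. -/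
def C₂ : ℕ → ℝ[X]
  | 0 => 0
  | 1 => -(C (1 / D.h 0) * D.massSum 0 (D.P 0))
  | n + 2 => -(C (1 / D.γ₂ (n + 1)) * D.B₂ (n + 1))

def D₂ : ℕ → ℝ[X]
  | 0 => 0
  | n + 1 => D.A₂ n - D.C₂ (n + 1) * (X - C (D.γ₁ n))

/-- `(1 - x²) (ρ S_{n-1})' = C₃ P_n + D₃ P_{n-1}`, for `n ≥ 1`. In general
`C₃ n = -B₃ (n-1) / γ₂ (n-1)`; since `bHat m / γ₂ m = 2 m + α + β + 1`, this equals
`C₂' * (1 - x²) - (2 n + α + β - 1) * A₂ (n-1) + cHat (n-1) * C₂`, which is taken for `n = 1`. -/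
def C₃ : ℕ → ℝ[X]
  | 0 => 0
  | 1 => derivative (D.C₂ 1) * (1 - X ^ 2) - C (D.α + D.β + 1) * D.A₂ 0 + D.cHat 0 * D.C₂ 1
  | n + 2 => -(C (1 / D.γ₂ (n + 1)) * D.B₃ (n + 1))

def D₃ : ℕ → ℝ[X]
  | 0 => 0
  | n + 1 => D.A₃ n - D.C₃ (n + 1) * (X - C (D.γ₁ n))

/-- The determinant `Δ_n`. -/
def Δ (n : ℕ) : ℝ[X] := D.A₂ n * D.D₂ n - D.C₂ n * D.B₂ n

/-- `δ_n = Δ_n / ρ`. -/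
def δ (n : ℕ) : RatFunc ℝ :=
  algebraMap ℝ[X] (RatFunc ℝ) (D.Δ n) / algebraMap ℝ[X] (RatFunc ℝ) D.ρ

def q₀ (n : ℕ) : RatFunc ℝ := algebraMap ℝ[X] (RatFunc ℝ) ((1 - X ^ 2) * D.Δ n)

def q₃ (n : ℕ) : RatFunc ℝ :=
  algebraMap ℝ[X] (RatFunc ℝ) ((1 - X ^ 2) * derivative D.ρ) * D.δ n +
    algebraMap ℝ[X] (RatFunc ℝ) (D.C₃ n * D.B₂ n - D.D₃ n * D.A₂ n)

def q₄ (n : ℕ) : RatFunc ℝ :=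
  algebraMap ℝ[X] (RatFunc ℝ) (D.C₃ n * D.D₂ n - D.D₃ n * D.C₂ n)

/-- The raising Jacobi-Sobolev differential operator `(q₃ / q₄) I + (q₀ / q₄) d/dx`. -/
def raising (n : ℕ) (f : RatFunc ℝ) : RatFunc ℝ :=
  D.q₃ n / D.q₄ n * f + D.q₀ n / D.q₄ n * ratDeriv f

/-- The composition of the raising operators of indices `n, n - 1, …, 1` (the identity if
`n = 0`), the one of index `1` being applied first. -/
def raisingComp : ℕ → RatFunc ℝ → RatFunc ℝ
  | 0 => id
  | n + 1 => D.raising (n + 1) ∘ raisingComp n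

end Data

end JacobiSobolev

end

open scoped Polynomial

noncomputable section

namespace JacobiSobolev

open Polynomial

/-! ### Monic orthogonal polynomials of a positive definite form -/

section PosDef

variable {B : LinearMap.BilinForm ℝ ℝ[X]}

/-! Adding nonnegative masses keeps the Jacobi form positive definite, so `S n` and `P n` are the
monic orthogonal polynomials of degree `n`. Expand `S n - P n` in Jacobi polynomials: orthogonality
of `S n` turns its coefficients into mass terms, and the sums that appear are derivatives of the
Christoffel–Darboux kernel at the points `c j`. Multiplication by `ρ` clears the denominators of
these kernels (`christoffel_darboux`), so `ρ S_n` is a polynomial combination of `P_n` and `P_{n-1}`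
(`ρ_mul_S`).

The relations `structure_raise` and `structure_lower` do the same for `(1 - x²)(ρ S_n)'`, and the
three-term recurrence rewrites the formulas for `S_{n-1}` in the pair `P_n`, `P_{n-1}`. Thus `ρ
S_n`, `ρ S_{n-1}` and `(1 - x²)(ρ S_{n-1})'` are three vectors over a two-element system, and their
linear dependence is `raising_identity`, which becomes the raising operator after division by `ρ`
and `q₄`.

What remains is `q₄_ne_zero`. For `n ≥ 2`, up to a nonzero constant, `q₄ n` is the determinant `A₃
B₂ - B₃ A₂` at `m = n - 1`, whose coefficient in degree `2 deg ρ` is `-(2m + α + β + 1) ⟨S_m, S_m⟩_s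
/ h_{m-1}`, which is nonzero. For `n = 1` the corresponding factor is `α + β + 1`; if it vanishes,
evaluation at `x = α - β` gives a positive value as soon as some `lam j 0` is positive. -/

lemma orth_of_forall_pow {n : ℕ} {p q : ℝ[X]} (h : ∀ k < n, B (X ^ k) p = 0)
    (hq : q.degree < n) : B q p = 0 := by
  by_cases hq0 : q = 0
  · simp [hq0]
  have hlt : q.natDegree < n := (natDegree_lt_iff_degree_lt hq0).2 hq
  rw [q.as_sum_range' n hlt, map_sum, LinearMap.sum_apply]
  refine Finset.sum_eq_zero fun k hk => ?_
  rw [← C_mul_X_pow_eq_monomial, ← smul_eq_C_mul, map_smul, LinearMap.smul_apply,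
    h k (Finset.mem_range.1 hk), smul_zero]

lemma eq_zero_of_orth_self (hB : ∀ f : ℝ[X], f ≠ 0 → 0 < B f f) {p : ℝ[X]} (h : B p p = 0) :
    p = 0 := by
  by_contra hp
  exact (hB p hp).ne' h

/-- Subtract from `X ^ n` its orthogonal projection to degree below `n`. Positivity makes the map
into the dual of that finite-dimensional space injective, hence surjective, which produces the
projection. -/
lemma exists_monic_orth (hB : ∀ f : ℝ[X], f ≠ 0 → 0 < B f f) (n : ℕ) :
    ∃ p : ℝ[X], p.Monic ∧ p.natDegree = n ∧ ∀ k < n, B (X ^ k) p = 0 := by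
  let V := degreeLT ℝ n
  let φ : V →ₗ[ℝ] Module.Dual ℝ V := LinearMap.domRestrict₁₂ B.flip V V
  have : FiniteDimensional ℝ V := Module.Finite.equiv (degreeLTEquiv ℝ n).symm
  have hinj : Function.Injective φ := by
    rw [← LinearMap.ker_eq_bot, LinearMap.ker_eq_bot']
    intro r hr
    exact Subtype.ext (eq_zero_of_orth_self hB (LinearMap.congr_fun hr r))
  have hsurj : Function.Surjective φ :=
    (LinearMap.injective_iff_surjective_of_finrank_eq_finrank
      Subspace.dual_finrank_eq.symm).1 hinj
  obtain ⟨r, hr⟩ := hsurj ((B.flip (X ^ n)).comp V.subtype)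
  have hdeg : (r : ℝ[X]).degree < (X ^ n : ℝ[X]).degree := by
    rw [degree_X_pow]
    exact mem_degreeLT.1 r.2
  refine ⟨X ^ n - (r : ℝ[X]), (monic_X_pow n).sub_of_left hdeg, ?_, fun k hk => ?_⟩
  · rw [natDegree_eq_of_degree_eq (degree_sub_eq_left_of_degree_lt hdeg), natDegree_X_pow]
  · have hk' : (X ^ k : ℝ[X]) ∈ V := mem_degreeLT.2 (by rw [degree_X_pow]; exact_mod_cast hk)
    have := LinearMap.congr_fun hr ⟨X ^ k, hk'⟩
    change B (X ^ k) r = B (X ^ k) (X ^ n) at this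
    rw [map_sub, this, sub_self]

lemma le_natDegree_of_orth (hB : ∀ f : ℝ[X], f ≠ 0 → 0 < B f f) {n : ℕ} {p : ℝ[X]}
    (hp : p.Monic) (h : ∀ k < n, B (X ^ k) p = 0) : n ≤ p.natDegree := by
  by_contra! hlt
  exact hp.ne_zero (eq_zero_of_orth_self hB
    (orth_of_forall_pow h ((natDegree_lt_iff_degree_lt hp.ne_zero).1 hlt)))

/-- The arbitrary choice in `monicOrth` is harmless: a polynomial of degree `n` is a candidate, and
none has lower degree, since it would be orthogonal to itself. -/
lemma monicOrth_spec (hB : ∀ f : ℝ[X], f ≠ 0 → 0 < B f f) (n : ℕ) :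
    (monicOrth (fun f g => B f g) n).Monic ∧ (monicOrth (fun f g => B f g) n).natDegree = n ∧
      ∀ q : ℝ[X], q.degree < n → B q (monicOrth (fun f g => B f g) n) = 0 := by
  obtain ⟨p, hp, hpn, ho⟩ := exists_monic_orth hB n
  have hspec : IsMonicOrth (fun f g => B f g) n (monicOrth (fun f g => B f g) n) :=
    Classical.epsilon_spec (p := IsMonicOrth (fun f g => B f g) n)
      ⟨p, hp, ho, fun q hq hqo => hpn ▸ le_natDegree_of_orth hB hq hqo⟩
  obtain ⟨h1, h2, h3⟩ := hspec
  exact ⟨h1, le_antisymm ((h3 p hp ho).trans hpn.le) (le_natDegree_of_orth hB h1 h2),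
    fun q hq => orth_of_forall_pow h2 hq⟩

end PosDef

/-- A polynomial of degree less than `n + 1` minus its top coefficient times a monic polynomial of
degree `n` has degree less than `n`. -/
lemma degree_sub_C_coeff_mul_lt {n : ℕ} {p r : ℝ[X]} (hp : p.Monic) (hpn : p.natDegree = n)
    (hr : r.degree < (n + 1 : ℕ)) : (r - C (r.coeff n) * p).degree < n := by
  rw [degree_lt_iff_coeff_zero]
  intro m hm
  rw [coeff_sub, coeff_C_mul]
  rcases hm.eq_or_lt with rfl | hm
  · rw [← hpn, hp.coeff_natDegree, mul_one, sub_self]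
  · rw [coeff_eq_zero_of_natDegree_lt (hpn.trans_lt hm),
      coeff_eq_zero_of_degree_lt (hr.trans_le (by exact_mod_cast hm)), mul_zero, sub_zero]

lemma exists_expansion {p : ℕ → ℝ[X]} (hp : ∀ n, (p n).Monic) (hpn : ∀ n, (p n).natDegree = n)
    (n : ℕ) : ∀ r : ℝ[X], r.degree < n → ∃ a : ℕ → ℝ, r = ∑ i ∈ Finset.range n, C (a i) * p i := by
  induction n with
  | zero =>
    intro r hr
    exact ⟨0, by simpa using hr⟩
  | succ n ih =>
    intro r hr
    obtain ⟨a, ha⟩ := ih _ (degree_sub_C_coeff_mul_lt (hp n) (hpn n) hr)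
    refine ⟨Function.update a n (r.coeff n), ?_⟩
    rw [Finset.sum_range_succ, Function.update_self]
    rw [Finset.sum_congr rfl (g := fun i => C (a i) * p i), ← ha, sub_add_cancel]
    intro i hi
    rw [Function.update_of_ne (Finset.mem_range.1 hi).ne]

/-- Expansion along an orthogonal sequence of monic polynomials. -/
lemma expansion {B : LinearMap.BilinForm ℝ ℝ[X]} {p : ℕ → ℝ[X]} (hp : ∀ n, (p n).Monic)
    (hpn : ∀ n, (p n).natDegree = n) (ho : ∀ i j, i ≠ j → B (p i) (p j) = 0)
    (h0 : ∀ i, B (p i) (p i) ≠ 0) {n : ℕ} {r : ℝ[X]} (hr : r.degree < n) :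
    r = ∑ i ∈ Finset.range n, C (B (p i) r / B (p i) (p i)) * p i := by
  obtain ⟨a, ha⟩ := exists_expansion hp hpn n r hr
  conv_lhs => rw [ha]
  refine Finset.sum_congr rfl fun i hi => ?_
  suffices B (p i) r = a i * B (p i) (p i) by rw [this, mul_div_cancel_right₀ _ (h0 i)]
  rw [ha, map_sum, Finset.sum_eq_single i]
  · rw [← smul_eq_C_mul, map_smul, smul_eq_mul]
  · intro j _ hj
    rw [← smul_eq_C_mul, map_smul, ho i j hj.symm, smul_zero]
  · exact fun h => absurd hi h

/-! ### The Jacobi weight -/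

namespace Data

open MeasureTheory intervalIntegral

/-- The Jacobi weight. -/
def weight (D : Data) (x : ℝ) : ℝ := (1 - x) ^ D.α * (1 + x) ^ D.β

variable {D : Data}

lemma intervalIntegrable_weight (hα : -1 < D.α) (hβ : -1 < D.β) :
    IntervalIntegrable D.weight volume (-1) 1 := by
  have h1 : IntervalIntegrable (fun x : ℝ => (1 - x) ^ D.α) volume 0 1 := by
    simpa using (intervalIntegrable_rpow' (a := 1) (b := 0) hα).comp_sub_left 1
  have h2 : IntervalIntegrable (fun x : ℝ => (1 + x) ^ D.β) volume (-1) 0 := by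
    simpa using (intervalIntegrable_rpow' (a := 0) (b := 1) hβ).comp_add_left 1
  -- Each half of the interval contains only one possible singularity; the other factor is
  -- continuous there.
  refine IntervalIntegrable.trans (b := 0) ?_ ?_
  · refine h2.continuousOn_mul ?_
    intro x hx
    rw [Set.uIcc_of_le (by norm_num)] at hx
    exact (ContinuousAt.rpow_const (by fun_prop)
      (Or.inl (by linarith [hx.2] : (1 - x : ℝ) ≠ 0))).continuousWithinAt
  · refine h1.mul_continuousOn ?_
    intro x hx
    rw [Set.uIcc_of_le (by norm_num)] at hx
    exact (ContinuousAt.rpow_const (by fun_prop)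
      (Or.inl (by linarith [hx.1] : (1 + x : ℝ) ≠ 0))).continuousWithinAt

lemma intervalIntegrable_eval_mul_weight (hα : -1 < D.α) (hβ : -1 < D.β) (f : ℝ[X]) :
    IntervalIntegrable (fun x => f.eval x * D.weight x) volume (-1) 1 :=
  (intervalIntegrable_weight hα hβ).continuousOn_mul f.continuous.continuousOn

/-- Integration against the Jacobi weight, as a linear functional on polynomials. -/
def jacobiL (hα : -1 < D.α) (hβ : -1 < D.β) : ℝ[X] →ₗ[ℝ] ℝ where
  toFun f := ∫ x in (-1 : ℝ)..1, f.eval x * D.weight x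
  map_add' f g := by
    simp only [eval_add, add_mul]
    exact integral_add (intervalIntegrable_eval_mul_weight hα hβ f)
      (intervalIntegrable_eval_mul_weight hα hβ g)
  map_smul' a f := by
    simp only [eval_smul, smul_eq_mul, mul_assoc, RingHom.id_apply]
    exact integral_const_mul _ _

lemma ipJacobi_eq (hα : -1 < D.α) (hβ : -1 < D.β) (f g : ℝ[X]) :
    D.ipJacobi f g = jacobiL hα hβ (f * g) := by
  simp [ipJacobi, jacobiL, weight]

lemma weight_pos {x : ℝ} (hx : x ∈ Set.Ioo (-1 : ℝ) 1) : 0 < D.weight x :=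
  mul_pos (Real.rpow_pos_of_pos (by linarith [hx.2]) _)
    (Real.rpow_pos_of_pos (by linarith [hx.1]) _)

lemma weight_nonneg {x : ℝ} (hx : x ∈ Set.Icc (-1 : ℝ) 1) : 0 ≤ D.weight x :=
  mul_nonneg (Real.rpow_nonneg (by linarith [hx.2]) _) (Real.rpow_nonneg (by linarith [hx.1]) _)

lemma jacobiL_mul_self_pos (hα : -1 < D.α) (hβ : -1 < D.β) {f : ℝ[X]} (hf : f ≠ 0) :
    0 < jacobiL hα hβ (f * f) := by
  have hint := intervalIntegrable_eval_mul_weight hα hβ (f * f)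
  refine (integral_pos_iff_support_of_nonneg_ae' ?_ hint).2 ⟨by norm_num, ?_⟩
  · rw [Set.uIoc_of_le (by norm_num)]
    refine (ae_restrict_iff' measurableSet_Ioc).2 (Filter.Eventually.of_forall fun x hx => ?_)
    simp only [eval_mul, Pi.zero_apply]
    exact mul_nonneg (mul_self_nonneg _) (weight_nonneg ⟨hx.1.le, hx.2⟩)
  · have hsub : Set.Ioo (-1 : ℝ) 1 \ (f.roots.toFinset : Set ℝ) ⊆
        Function.support (fun x => (f * f).eval x * D.weight x) ∩ Set.Ioc (-1) 1 := by
      rintro x ⟨hx, hxr⟩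
      refine ⟨?_, hx.1, hx.2.le⟩
      have hfx : f.eval x ≠ 0 := by simpa [hf] using hxr
      simp [hfx, (weight_pos hx).ne']
    refine lt_of_lt_of_le ?_ (measure_mono hsub)
    rw [measure_sdiff_null (Finset.measure_zero _ _)]
    simp

/-- Integration by parts: the integral of the derivative of `f · (1 - x)^(α+1) (1 + x)^(β+1)` is
zero because both exponents are positive, which kills the boundary terms. -/
lemma jacobiL_pearson (hα : -1 < D.α) (hβ : -1 < D.β) (f : ℝ[X]) :
    jacobiL hα hβ ((1 - X ^ 2) * derivative f) =
      jacobiL hα hβ ((C (D.α + D.β + 2) * X + C (D.α - D.β)) * f) := by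
  rw [← sub_eq_zero, ← map_sub]
  set g : ℝ[X] := (1 - X ^ 2) * derivative f - (C (D.α + D.β + 2) * X + C (D.α - D.β)) * f
    with hg
  let F : ℝ → ℝ := fun x => f.eval x * ((1 - x) ^ (D.α + 1) * (1 + x) ^ (D.β + 1))
  have hcont : Continuous F := by
    refine f.continuous.mul (Continuous.mul ?_ ?_)
    · exact Continuous.rpow_const (by fun_prop) fun x => Or.inr (by linarith)
    · exact Continuous.rpow_const (by fun_prop) fun x => Or.inr (by linarith)
  have hderiv : ∀ x ∈ Set.Ioo (-1 : ℝ) 1, HasDerivAt F (g.eval x * D.weight x) x := by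
    intro x hx
    have p1 : 0 < 1 - x := by linarith [hx.2]
    have p2 : 0 < 1 + x := by linarith [hx.1]
    have d1 : HasDerivAt (fun y : ℝ => (1 - y) ^ (D.α + 1)) (-1 * (D.α + 1) * (1 - x) ^ D.α) x := by
      simpa using ((hasDerivAt_id x).const_sub 1).rpow_const (p := D.α + 1) (Or.inl p1.ne')
    have d2 : HasDerivAt (fun y : ℝ => (1 + y) ^ (D.β + 1)) ((D.β + 1) * (1 + x) ^ D.β) x := by
      simpa using ((hasDerivAt_id x).const_add 1).rpow_const (p := D.β + 1) (Or.inl p2.ne')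
    refine ((f.hasDerivAt x).mul (d1.mul d2)).congr_deriv ?_
    simp only [hg, weight, Pi.mul_apply, eval_sub, eval_mul, eval_add, eval_C, eval_X, eval_one,
      eval_pow, Real.rpow_add_one p1.ne', Real.rpow_add_one p2.ne']
    ring
  have := integral_eq_sub_of_hasDerivAt_of_le (by norm_num) hcont.continuousOn hderiv
    (intervalIntegrable_eval_mul_weight hα hβ g)
  change ∫ x in (-1 : ℝ)..1, g.eval x * D.weight x = 0
  rw [this]
  have z1 : (0 : ℝ) ^ (D.α + 1) = 0 := Real.zero_rpow (by linarith)
  have z2 : (0 : ℝ) ^ (D.β + 1) = 0 := Real.zero_rpow (by linarith)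
  simp [F, z1, z2]

/-! ### Jacobi polynomials -/

/-- The Jacobi inner product as a bilinear form. -/
def jacobiForm (hα : -1 < D.α) (hβ : -1 < D.β) : LinearMap.BilinForm ℝ ℝ[X] :=
  (LinearMap.mul ℝ ℝ[X]).compr₂ (jacobiL hα hβ)

@[simp]
lemma jacobiForm_apply (hα : -1 < D.α) (hβ : -1 < D.β) (f g : ℝ[X]) :
    jacobiForm hα hβ f g = jacobiL hα hβ (f * g) := rfl

lemma jacobiL_C_mul (hα : -1 < D.α) (hβ : -1 < D.β) (a : ℝ) (f : ℝ[X]) :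
    jacobiL hα hβ (C a * f) = a * jacobiL hα hβ f := by
  rw [← smul_eq_C_mul, map_smul, smul_eq_mul]

lemma P_spec (hα : -1 < D.α) (hβ : -1 < D.β) (n : ℕ) :
    (D.P n).Monic ∧ (D.P n).natDegree = n ∧
      ∀ q : ℝ[X], q.degree < n → jacobiL hα hβ (q * D.P n) = 0 := by
  have : D.P n = monicOrth (fun f g => jacobiForm hα hβ f g) n := by
    simp only [P, jacobiForm_apply, ← ipJacobi_eq]
  rw [this]
  exact monicOrth_spec (B := jacobiForm hα hβ) (fun f hf => jacobiL_mul_self_pos hα hβ hf) n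

lemma P_monic (hα : -1 < D.α) (hβ : -1 < D.β) (n : ℕ) : (D.P n).Monic := (P_spec hα hβ n).1

lemma P_natDegree (hα : -1 < D.α) (hβ : -1 < D.β)
    (n : ℕ) : (D.P n).natDegree = n := (P_spec hα hβ n).2.1

lemma P_degree (hα : -1 < D.α) (hβ : -1 < D.β) (n : ℕ) : (D.P n).degree = n := by
  rw [degree_eq_natDegree (P_monic hα hβ n).ne_zero, P_natDegree hα hβ]

lemma P_zero (hα : -1 < D.α) (hβ : -1 < D.β)
    : D.P 0 = 1 := (P_monic hα hβ 0).natDegree_eq_zero.1 (P_natDegree hα hβ 0)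

lemma P_coeff_self (hα : -1 < D.α) (hβ : -1 < D.β) (n : ℕ) : (D.P n).coeff n = 1 := by
  simpa [P_natDegree hα hβ n] using (P_monic hα hβ n).coeff_natDegree

lemma P_coeff_eq_zero (hα : -1 < D.α) (hβ : -1 < D.β) {n m : ℕ} (h : n < m) : (D.P n).coeff m = 0 :=
  coeff_eq_zero_of_natDegree_lt ((P_natDegree hα hβ n).trans_lt h)

lemma jacobiL_mul_P_eq_zero (hα : -1 < D.α) (hβ : -1 < D.β) {n : ℕ} {q : ℝ[X]} (hq : q.degree < n) :
    jacobiL hα hβ (q * D.P n) = 0 := (P_spec hα hβ n).2.2 q hq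

lemma h_eq (hα : -1 < D.α) (hβ : -1 < D.β)
    (n : ℕ) : D.h n = jacobiL hα hβ (D.P n * D.P n) := ipJacobi_eq hα hβ _ _

lemma h_pos (hα : -1 < D.α) (hβ : -1 < D.β) (n : ℕ) : 0 < D.h n := by
  rw [h_eq hα hβ]
  exact jacobiL_mul_self_pos hα hβ (P_monic hα hβ n).ne_zero

lemma jacobiL_mul_P (hα : -1 < D.α) (hβ : -1 < D.β)
    {n : ℕ} {q : ℝ[X]} (hq : q.degree < (n + 1 : ℕ)) :
    jacobiL hα hβ (q * D.P n) = q.coeff n * D.h n := by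
  have := jacobiL_mul_P_eq_zero hα hβ
    (degree_sub_C_coeff_mul_lt (P_monic hα hβ n) (P_natDegree hα hβ n) hq)
  rw [sub_mul, map_sub, mul_assoc, jacobiL_C_mul, ← h_eq hα hβ, sub_eq_zero] at this
  exact this

lemma jacobiL_P_mul_P (hα : -1 < D.α) (hβ : -1 < D.β)
    {i j : ℕ} (hij : i ≠ j) : jacobiL hα hβ (D.P i * D.P j) = 0 := by
  rcases lt_or_gt_of_ne hij with h | h
  · exact jacobiL_mul_P_eq_zero hα hβ (by rw [P_degree hα hβ]; exact_mod_cast h)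
  · rw [mul_comm]
    exact jacobiL_mul_P_eq_zero hα hβ (by rw [P_degree hα hβ]; exact_mod_cast h)

lemma expansion_P (hα : -1 < D.α) (hβ : -1 < D.β) {n : ℕ} {r : ℝ[X]} (hr : r.degree < n) :
    r = ∑ i ∈ Finset.range n, C (jacobiL hα hβ (D.P i * r) / D.h i) * D.P i := by
  have := expansion (B := jacobiForm hα hβ) (P_monic hα hβ) (P_natDegree hα hβ)
    (fun i j hij => jacobiL_P_mul_P hα hβ hij)
    (fun i => by rw [jacobiForm_apply, ← h_eq hα hβ]; exact (h_pos hα hβ i).ne') hr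
  simpa only [jacobiForm_apply, ← h_eq hα hβ] using this

/-- `P_{n-1}`, with the convention `P_{-1} = 0`. -/
def Pprev (D : Data) : ℕ → ℝ[X]
  | 0 => 0
  | n + 1 => D.P n

/-- `γ₂ n`, with the convention `γ₂ 0 = 0`. -/
def γ₂z (D : Data) : ℕ → ℝ
  | 0 => 0
  | n + 1 => D.γ₂ (n + 1)

/-- A polynomial of degree at most `n` that is orthogonal to all polynomials of degree less than
`n - 1` is a combination of `P_n` and `P_{n-1}`. -/
lemma expansion_two (hα : -1 < D.α) (hβ : -1 < D.β)
    {n : ℕ} {r : ℝ[X]} (hr : r.degree < (n + 1 : ℕ)) {a b : ℝ}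
    (h0 : ∀ i, i + 1 < n → jacobiL hα hβ (D.P i * r) = 0)
    (ha : jacobiL hα hβ (D.P n * r) = a * D.h n)
    (hb : ∀ i, n = i + 1 → jacobiL hα hβ (D.P i * r) = b * D.h n) :
    r = C a * D.P n + C (b * D.γ₂z n) * D.Pprev n := by
  have hn := (h_pos hα hβ n).ne'
  refine (expansion_P hα hβ hr).trans ?_
  rw [Finset.sum_range_succ, ha, mul_div_cancel_right₀ _ hn, add_comm]
  congr 1
  cases n with
  | zero => simp [Pprev]
  | succ n =>
    rw [Finset.sum_range_succ, Finset.sum_eq_zero, zero_add, hb n rfl]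
    · simp [Pprev, γ₂z, γ₂, mul_div_assoc]
    · intro i hi
      rw [h0 i (by simpa using hi)]
      simp

lemma degree_X_mul_P (hα : -1 < D.α) (hβ : -1 < D.β)
    (n : ℕ) : (X * D.P n).degree < ((n + 2 : ℕ) : WithBot ℕ) := by
  rw [degree_mul, degree_X, P_degree hα hβ]
  norm_cast
  omega

lemma three_term (hα : -1 < D.α) (hβ : -1 < D.β) (n : ℕ) :
    X * D.P n = D.P (n + 1) + C (D.γ₁ n) * D.P n + C (D.γ₂z n) * D.Pprev n := by
  rw [add_assoc, ← sub_eq_iff_eq_add']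
  have hdeg : (X * D.P n - D.P (n + 1)).degree < ((n + 1 : ℕ) : WithBot ℕ) := by
    have := degree_sub_C_coeff_mul_lt (P_monic hα hβ (n + 1)) (P_natDegree hα hβ (n + 1))
      (degree_X_mul_P hα hβ n)
    rwa [coeff_X_mul, P_coeff_self hα hβ, C_1, one_mul] at this
  have key := expansion_two hα hβ (a := D.γ₁ n) (b := 1) hdeg ?_ ?_ ?_
  · rwa [one_mul] at key
  · intro i hi
    rw [mul_sub, map_sub, jacobiL_P_mul_P hα hβ (by omega), sub_zero, mul_left_comm, ← mul_assoc]
    exact jacobiL_mul_P_eq_zero hα hβ ((degree_X_mul_P hα hβ i).trans_le (by exact_mod_cast hi))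
  · rw [mul_sub, map_sub, jacobiL_P_mul_P hα hβ (by omega), sub_zero, γ₁,
      div_mul_cancel₀ _ (h_pos hα hβ n).ne', ipJacobi_eq hα hβ]
  · rintro i rfl
    rw [mul_sub, map_sub, jacobiL_P_mul_P hα hβ (by omega), sub_zero, mul_left_comm, ← mul_assoc,
      jacobiL_mul_P hα hβ (degree_X_mul_P hα hβ i), coeff_X_mul, P_coeff_self hα hβ]

/-! ### The structure relation -/

lemma coeff_one_sub_sq_mul_derivative {f : ℝ[X]} {n : ℕ} (hf : f.natDegree ≤ n) {m : ℕ}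
    (hm : n < m) : ((1 - X ^ 2) * derivative f).coeff m =
      if m = n + 1 then -(n * f.coeff n) else 0 := by
  have hz : ∀ k, n < k → f.coeff k = 0 := fun k hk =>
    coeff_eq_zero_of_natDegree_lt (hf.trans_lt hk)
  rw [sub_mul, one_mul, coeff_sub, coeff_X_pow_mul', coeff_derivative, hz (m + 1) (by omega)]
  rcases m with _ | _ | k
  · omega
  · obtain rfl : n = 0 := by omega
    simp
  · simp only [add_assoc, Nat.reduceAdd, le_add_iff_nonneg_left, zero_le, if_true,
      Nat.add_sub_cancel, coeff_derivative]
    split_ifs with h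
    · obtain rfl : n = k + 1 := by omega
      push_cast
      ring
    · rw [hz (k + 1) (by omega)]
      simp

/-- The diagonal coefficient of the structure relation. -/
def structCoeff (D : Data) (n : ℕ) : ℝ := ((D.α + D.β + 2) * D.γ₁ n + D.α - D.β) / 2

/-- Integration by parts moves the derivative from `P_n` to `P_i`, where it leaves a polynomial of
degree at most `i + 1`. So the pairing with `P_i` vanishes for `i < n - 1`; for `i = n - 1` the
leading coefficient gives its value; for `i = n` the pairing reappears with the opposite sign and is
solved for. -/
lemma structure_relation (hα : -1 < D.α) (hβ : -1 < D.β) (n : ℕ) :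
    (1 - X ^ 2) * derivative (D.P n) = -C (n : ℝ) * D.P (n + 1) + C (D.structCoeff n) * D.P n +
      C ((n + D.α + D.β + 1) * D.γ₂z n) * D.Pprev n := by
  set ψ : ℝ[X] := C (D.α + D.β + 2) * X + C (D.α - D.β) with hψ
  have hparts : ∀ i, jacobiL hα hβ (D.P i * ((1 - X ^ 2) * derivative (D.P n))) =
      jacobiL hα hβ ((ψ * D.P i - (1 - X ^ 2) * derivative (D.P i)) * D.P n) := by
    intro i
    have := jacobiL_pearson hα hβ (D.P i * D.P n)
    rw [derivative_mul] at this
    rw [sub_mul _ _ (D.P n), map_sub, mul_assoc ψ, ← this, ← map_sub]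
    congr 1
    ring
  have hdegq : ∀ i, (ψ * D.P i - (1 - X ^ 2) * derivative (D.P i)).degree <
      ((i + 2 : ℕ) : WithBot ℕ) := by
    intro i
    rw [degree_lt_iff_coeff_zero]
    intro m hm
    obtain ⟨m, rfl⟩ : ∃ k, m = k + 1 := ⟨m - 1, by omega⟩
    rw [coeff_sub, coeff_one_sub_sq_mul_derivative (P_natDegree hα hβ i).le (by omega),
      if_neg (by omega), hψ, add_mul, mul_assoc, coeff_add, coeff_C_mul, coeff_C_mul, coeff_X_mul,
      P_coeff_eq_zero hα hβ (by omega), P_coeff_eq_zero hα hβ (by omega)]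
    simp
  have hcoeffq : ∀ i : ℕ, (ψ * D.P i - (1 - X ^ 2) * derivative (D.P i)).coeff (i + 1) =
      (i + 1 : ℝ) + D.α + D.β + 1 := by
    intro i
    rw [coeff_sub, coeff_one_sub_sq_mul_derivative (P_natDegree hα hβ i).le (by omega),
      if_pos rfl, hψ, add_mul, mul_assoc, coeff_add, coeff_C_mul, coeff_C_mul, coeff_X_mul,
      P_coeff_eq_zero hα hβ (n := i) (m := i + 1) (by omega), P_coeff_self hα hβ]
    ring
  rw [add_assoc, ← sub_eq_iff_eq_add']
  have hdeg : ((1 - X ^ 2) * derivative (D.P n) - -C (n : ℝ) * D.P (n + 1)).degree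
      < ((n + 1 : ℕ) : WithBot ℕ) := by
    rw [degree_lt_iff_coeff_zero]
    intro m hm
    rw [coeff_sub, coeff_one_sub_sq_mul_derivative (P_natDegree hα hβ n).le (by omega), ← C_neg,
      coeff_C_mul]
    split_ifs with h
    · subst h
      rw [P_coeff_self hα hβ, P_coeff_self hα hβ]
      ring
    · rw [P_coeff_eq_zero hα hβ (by omega)]
      ring
  have hP : ∀ i, i < n + 1 →
      jacobiL hα hβ (D.P i * ((1 - X ^ 2) * derivative (D.P n) - -C (n : ℝ) * D.P (n + 1))) =
      jacobiL hα hβ (D.P i * ((1 - X ^ 2) * derivative (D.P n))) := by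
    intro i hi
    rw [mul_sub, map_sub, ← C_neg, ← smul_eq_C_mul, mul_smul_comm, map_smul,
      jacobiL_P_mul_P hα hβ (by omega), smul_zero, sub_zero]
  refine expansion_two hα hβ hdeg ?_ ?_ ?_
  · intro i hi
    rw [hP i (by omega), hparts]
    exact jacobiL_mul_P_eq_zero hα hβ ((hdegq i).trans_le (by exact_mod_cast hi))
  · rw [hP n (by omega)]
    have h1 := hparts n
    have h2 : jacobiL hα hβ (ψ * D.P n * D.P n) =
        (D.α + D.β + 2) * (D.γ₁ n * D.h n) + (D.α - D.β) * D.h n := by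
      rw [γ₁, div_mul_cancel₀ _ (h_pos hα hβ n).ne', ipJacobi_eq hα hβ, h_eq hα hβ,
        ← jacobiL_C_mul, ← jacobiL_C_mul, ← map_add]
      congr 1
      ring
    rw [sub_mul _ _ (D.P n), map_sub, h2, mul_comm _ (D.P n)] at h1
    rw [structCoeff]
    linarith
  · rintro i rfl
    rw [hP i (by omega), hparts, jacobiL_mul_P hα hβ (hdegq i), hcoeffq]
    push_cast
    ring

/-! ### Explicit recurrence coefficients -/

/-- The coefficient of `x ^ (n - 1)` in `P_n`. -/
def subCoeff (D : Data) (n : ℕ) : ℝ := (X ^ 2 * D.P n).coeff (n + 1)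

/-- The coefficient of `x ^ (n - 2)` in `P_n`. -/
def subsubCoeff (D : Data) (n : ℕ) : ℝ := (X ^ 2 * D.P n).coeff n

lemma coeff_sq_mul_P_self (hα : -1 < D.α) (hβ : -1 < D.β)
    (n : ℕ) : (X ^ 2 * D.P n).coeff (n + 2) = 1 := by
  rw [coeff_X_pow_mul, P_coeff_self hα hβ]

lemma coeff_sq_mul_P_eq_zero (hα : -1 < D.α) (hβ : -1 < D.β)
    (n m : ℕ) (hm : n + 2 < m) : (X ^ 2 * D.P n).coeff m = 0 := by
  obtain ⟨k, rfl⟩ : ∃ k, m = k + 2 := ⟨m - 2, by omega⟩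
  rw [coeff_X_pow_mul, P_coeff_eq_zero hα hβ (by omega)]

lemma γ₂z_mul_coeff_Pprev (hα : -1 < D.α) (hβ : -1 < D.β) (n : ℕ) :
    D.γ₂z n * (X ^ 2 * D.Pprev n).coeff (n + 1) = D.γ₂z n := by
  cases n with
  | zero => simp [γ₂z]
  | succ n => rw [Pprev, coeff_sq_mul_P_self hα hβ, mul_one]

lemma coeff_Pprev (hα : -1 < D.α) (hβ : -1 < D.β)
    (n : ℕ) : (X ^ 2 * D.Pprev n).coeff (n + 2) = 0 := by
  cases n with
  | zero => simp [Pprev]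
  | succ n => rw [Pprev, coeff_sq_mul_P_eq_zero hα hβ _ _ (by omega)]

/-- The factor `X ^ 2` lets the two coefficients of `P_n` below the leading one be read at
natural-number indices for every `n`, including `0` and `1`. -/
lemma three_term_sq (hα : -1 < D.α) (hβ : -1 < D.β) (n : ℕ) :
    X * (X ^ 2 * D.P n) = X ^ 2 * D.P (n + 1) + C (D.γ₁ n) * (X ^ 2 * D.P n) +
      C (D.γ₂z n) * (X ^ 2 * D.Pprev n) := by
  linear_combination X ^ 2 * three_term hα hβ n

lemma subCoeff_succ (hα : -1 < D.α) (hβ : -1 < D.β)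
    (n : ℕ) : D.subCoeff (n + 1) = D.subCoeff n - D.γ₁ n := by
  have := congrArg (fun p => coeff p (n + 2)) (three_term_sq hα hβ n)
  simp only [coeff_X_mul, coeff_add, coeff_C_mul, coeff_sq_mul_P_self hα hβ,
    coeff_Pprev hα hβ] at this
  simp only [subCoeff]
  linarith

lemma subsubCoeff_succ (hα : -1 < D.α) (hβ : -1 < D.β) (n : ℕ) :
    D.subsubCoeff (n + 1) = D.subsubCoeff n - D.γ₁ n * D.subCoeff n - D.γ₂z n := by
  have := congrArg (fun p => coeff p (n + 1)) (three_term_sq hα hβ n)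
  simp only [coeff_X_mul, coeff_add, coeff_C_mul, γ₂z_mul_coeff_Pprev hα hβ] at this
  simp only [subCoeff, subsubCoeff]
  linarith

lemma coeff_X_mul_derivative (f : ℝ[X]) (k : ℕ) : (X * derivative f).coeff k = k * f.coeff k := by
  cases k with
  | zero => simp
  | succ k =>
    rw [coeff_X_mul, coeff_derivative]
    push_cast
    ring

/-- This is `X ^ 3` times `structure_relation`, written through the Euler operator `X d/dx`, which
multiplies the `k`-th coefficient by `k`. -/
lemma structure_relation_sq (hα : -1 < D.α) (hβ : -1 < D.β) (n : ℕ) :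
    X * derivative (X ^ 2 * D.P n) - C 2 * (X ^ 2 * D.P n) -
      X ^ 2 * (X * derivative (X ^ 2 * D.P n) - C 2 * (X ^ 2 * D.P n)) =
    X * (-(C (n : ℝ) * (X ^ 2 * D.P (n + 1))) + C (D.structCoeff n) * (X ^ 2 * D.P n) +
      C (n + D.α + D.β + 1) * (C (D.γ₂z n) * (X ^ 2 * D.Pprev n))) := by
  have := structure_relation hα hβ n
  rw [C_mul] at this
  rw [derivative_mul, derivative_X_pow]
  simp only [Nat.cast_ofNat, Nat.add_one_sub_one, pow_one, map_ofNat]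
  linear_combination X ^ 3 * this

lemma subCoeff_eq (hα : -1 < D.α) (hβ : -1 < D.β)
    (n : ℕ) : D.subCoeff n = D.structCoeff n + n * D.γ₁ n := by
  have hθ := coeff_X_mul_derivative (X ^ 2 * D.P n)
  have := structure_relation_sq hα hβ n
  generalize X * derivative (X ^ 2 * D.P n) = θ at this hθ
  replace this := congrArg (fun p => coeff p (n + 3)) this
  rw [show n + 3 = (n + 1) + 2 from rfl] at this
  simp only [coeff_X_pow_mul, coeff_sub] at this
  rw [show n + 1 + 2 = (n + 2) + 1 from rfl] at this
  simp only [coeff_X_mul, coeff_add, coeff_neg, coeff_C_mul, hθ,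
    coeff_sq_mul_P_self hα hβ, coeff_Pprev hα hβ,
    coeff_sq_mul_P_eq_zero hα hβ n (n + 2 + 1) (by omega)] at this
  have h2 := subCoeff_succ hα hβ n
  simp only [subCoeff] at h2 ⊢
  push_cast at this
  rw [h2] at this
  linarith

lemma subsubCoeff_eq (hα : -1 < D.α) (hβ : -1 < D.β) (n : ℕ) :
    2 * D.subsubCoeff n =
      (2 * n + D.α + D.β + 1) * D.γ₂z n + D.subCoeff n ^ 2 - n := by
  have hθ := coeff_X_mul_derivative (X ^ 2 * D.P n)
  have := structure_relation_sq hα hβ n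
  generalize X * derivative (X ^ 2 * D.P n) = θ at this hθ
  replace this := congrArg (fun p => coeff p (n + 2)) this
  simp only [coeff_X_pow_mul, coeff_sub] at this
  rw [show n + 2 = (n + 1) + 1 from rfl] at this
  simp only [coeff_X_mul, coeff_add, coeff_neg, coeff_C_mul, hθ,
    coeff_sq_mul_P_self hα hβ, γ₂z_mul_coeff_Pprev hα hβ] at this
  have h1 := subsubCoeff_succ hα hβ n
  have h2 := subCoeff_eq hα hβ n
  simp only [subsubCoeff, subCoeff] at *
  push_cast at this
  rw [h1] at this
  have h4 : D.structCoeff n = (X ^ 2 * D.P n).coeff (n + 1) - n * D.γ₁ n := by linarith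
  rw [h4] at this
  linear_combination this

lemma γ₁_succ (hα : -1 < D.α) (hβ : -1 < D.β) (n : ℕ) :
    (2 * n + D.α + D.β + 4) * D.γ₁ (n + 1) = (2 * n + D.α + D.β) * D.γ₁ n := by
  have h1 := subCoeff_eq hα hβ n
  have h2 := subCoeff_eq hα hβ (n + 1)
  have h3 := subCoeff_succ hα hβ n
  simp only [structCoeff] at h1 h2
  push_cast at h2
  linear_combination 2 * h3 - 2 * h2 + 2 * h1

/-- By `γ₁_succ` the left side does not depend on `n`. At `n = 0` both sides carry the factor `α +
β`, so nothing about `γ₁ 0` follows if it is zero. -/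
lemma γ₁_eq (hα : -1 < D.α) (hβ : -1 < D.β) (n : ℕ) :
    (2 * n + D.α + D.β + 2) * ((2 * n + D.α + D.β) * D.γ₁ n) =
      (D.α + D.β) * (D.β - D.α) := by
  induction n with
  | zero =>
    have h1 := subCoeff_eq hα hβ 0
    have h0 : D.subCoeff 0 = 0 := by simp [subCoeff, P_zero hα hβ, coeff_X_pow]
    simp only [structCoeff, h0] at h1
    push_cast at h1 ⊢
    linear_combination -2 * (D.α + D.β) * h1
  | succ n ih =>
    push_cast
    linear_combination ih + (2 * n + D.α + D.β + 2) * γ₁_succ hα hβ n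

lemma γ₂z_succ (hα : -1 < D.α) (hβ : -1 < D.β) (n : ℕ) :
    (2 * n + D.α + D.β + 3) * D.γ₂z (n + 1) =
      (2 * n + D.α + D.β - 1) * D.γ₂z n + 1 - D.γ₁ n ^ 2 := by
  have h1 := subsubCoeff_eq hα hβ n
  have h2 := subsubCoeff_eq hα hβ (n + 1)
  have h3 := subsubCoeff_succ hα hβ n
  have h4 := subCoeff_succ hα hβ n
  rw [h4, h3] at h2
  push_cast at h2
  linear_combination h1 - h2

/-- With denominators cleared, the factor cancelled in `bHat 1` is restored on both sides, so `n =
1` obeys the general formula even if `α + β = -1`. -/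
lemma bHat_mul (hα : -1 < D.α) (hβ : -1 < D.β) (n : ℕ) (hn : 1 ≤ n) :
    (2 * n + D.α + D.β) ^ 2 * ((2 * n + D.α + D.β - 1) * D.bHat n) =
      4 * n * (n + D.α) * (n + D.β) * (n + D.α + D.β) := by
  have hn' : (1 : ℝ) ≤ n := by exact_mod_cast hn
  have h2 : 2 * n + D.α + D.β ≠ 0 := by linarith
  rcases n with _ | _ | n
  · omega
  · simp only [bHat]
    have h3 : 2 + D.α + D.β ≠ 0 := by linarith
    push_cast
    field_simp
    ring
  · have h3 : 2 * ((n + 1 + 1 : ℕ) : ℝ) + D.α + D.β - 1 ≠ 0 := by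
      push_cast
      have : (0 : ℝ) ≤ n := n.cast_nonneg
      intro h
      linarith
    simp only [bHat]
    field_simp

/-- Induction along the first-order recurrence `γ₂z_succ`, with `γ₁` known from `γ₁_eq`. -/
lemma bHat_eq (hα : -1 < D.α) (hβ : -1 < D.β)
    (n : ℕ) : D.bHat n = (2 * n + D.α + D.β + 1) * D.γ₂z n := by
  induction n with
  | zero => simp [bHat, γ₂z]
  | succ n ih =>
    have hrec := γ₂z_succ hα hβ n
    have hγ := γ₁_eq hα hβ n
    have hp2 : 2 * (n : ℝ) + D.α + D.β + 2 ≠ 0 := by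
      have : (0 : ℝ) ≤ n := n.cast_nonneg
      linarith
    have e : (2 * ((n + 1 : ℕ) : ℝ) + D.α + D.β + 1) = 2 * n + D.α + D.β + 3 := by
      push_cast
      ring
    rw [e, hrec]
    rcases Nat.eq_zero_or_pos n with rfl | hn
    -- `γ₁ 0` is computed directly here, since `γ₁_eq` does not determine it when `α + β = 0`.
    · have h1 := subCoeff_eq hα hβ 0
      have h0 : D.subCoeff 0 = 0 := by simp [subCoeff, P_zero hα hβ, coeff_X_pow]
      simp only [structCoeff, h0] at h1
      have h3 : 2 + D.α + D.β ≠ 0 := by linarith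
      have hg : D.γ₁ 0 = (D.β - D.α) / (2 + D.α + D.β) := by
        rw [eq_div_iff h3]
        linear_combination -2 * h1
      simp only [bHat, γ₂z, hg]
      field_simp
      ring
    · have hn' : (1 : ℝ) ≤ n := by exact_mod_cast hn
      have hb := bHat_mul hα hβ n hn
      have hb' := bHat_mul hα hβ (n + 1) (by omega)
      have hp0 : 2 * (n : ℝ) + D.α + D.β ≠ 0 := by linarith
      have hp1 : 2 * (n : ℝ) + D.α + D.β + 1 ≠ 0 := by linarith
      rw [ih] at hb
      push_cast at hb'
      generalize D.bHat (n + 1) = b at *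
      generalize D.γ₂z n = g at *
      generalize D.γ₁ n = γ at *
      generalize (n : ℝ) = x at *
      refine mul_left_cancel₀ (mul_ne_zero (mul_ne_zero (pow_ne_zero 2 hp2) hp1)
        (pow_ne_zero 2 hp0)) ?_
      linear_combination (2 * x + D.α + D.β) ^ 2 * hb' - (2 * x + D.α + D.β + 2) ^ 2 * hb
        + (2 * x + D.α + D.β + 1) *
          ((2 * x + D.α + D.β + 2) * ((2 * x + D.α + D.β) * γ) + (D.α + D.β) * (D.β - D.α)) * hγ

/-! ### The structure relations in explicit form -/

/-- `P_{n+2}` is eliminated from `structure_relation` at `n + 1` by the three-term recurrence; in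
`structure_lower` it is `P_{n-1}` that is eliminated. -/
lemma structure_raise (hα : -1 < D.α) (hβ : -1 < D.β) (n : ℕ) :
    (1 - X ^ 2) * derivative (D.P (n + 1)) =
      D.aHat (n + 1) * D.P (n + 1) + C (D.bHat (n + 1)) * D.P n := by
  have h1 := structure_relation hα hβ (n + 1)
  have h2 := three_term hα hβ (n + 1)
  have hγ := γ₁_eq hα hβ (n + 1)
  have hx : (0 : ℝ) ≤ n := n.cast_nonneg
  have hp : 2 * ((n + 1 : ℕ) : ℝ) + D.α + D.β ≠ 0 := by push_cast; linarith
  have ha : D.aHat (n + 1) = -C ((n + 1 : ℕ) : ℝ) * X +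
      C (((n + 1 : ℕ) : ℝ) * D.γ₁ (n + 1) + D.structCoeff (n + 1)) := by
    have e : ((n + 1 : ℕ) : ℝ) * D.γ₁ (n + 1) + D.structCoeff (n + 1) =
        -(((n + 1 : ℕ) : ℝ) / (2 * (n + 1 : ℕ) + D.α + D.β) * (D.β - D.α)) := by
      rw [structCoeff]
      generalize ((n + 1 : ℕ) : ℝ) = x at *
      generalize D.γ₁ (n + 1) = γ at *
      rw [div_mul_eq_mul_div, ← neg_div, eq_div_iff hp]
      linear_combination hγ / 2
    have e2 : ((n + 1 : ℕ) : ℝ) / (2 * (n + 1 : ℕ) + D.α + D.β) * (2 * (n + 1 : ℕ) + D.α + D.β)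
        = (n + 1 : ℕ) := div_mul_cancel₀ _ hp
    rw [aHat, e, neg_mul, mul_add, ← mul_assoc, ← C_mul, ← C_mul, e2, C_neg]
    ring
  rw [ha, bHat_eq hα hβ, h1]
  simp only [Pprev] at h2 ⊢
  have e3 : C ((2 * ((n + 1 : ℕ) : ℝ) + D.α + D.β + 1) * D.γ₂z (n + 1)) =
      C ((((n + 1 : ℕ) : ℝ) + D.α + D.β + 1) * D.γ₂z (n + 1)) +
      C ((n + 1 : ℕ) : ℝ) * C (D.γ₂z (n + 1)) := by
    rw [← C_mul, ← C_add]
    congr 1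
    ring
  rw [e3, C_add, C_mul (a := ((n + 1 : ℕ) : ℝ))]
  linear_combination C ((n + 1 : ℕ) : ℝ) * h2

lemma structure_lower (hα : -1 < D.α) (hβ : -1 < D.β) (n : ℕ) :
    (1 - X ^ 2) * derivative (D.P n) =
      D.cHat (n + 1) * D.P n + C (D.dHat (n + 1)) * D.P (n + 1) := by
  have h1 := structure_relation hα hβ n
  have h2 := three_term hα hβ n
  have hγ := γ₁_eq hα hβ n
  have hx : (0 : ℝ) ≤ n := n.cast_nonneg
  have hp : 2 * ((n + 1 : ℕ) : ℝ) + D.α + D.β ≠ 0 := by push_cast; linarith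
  have hc : D.cHat (n + 1) = C ((n : ℝ) + D.α + D.β + 1) * X +
      C (D.structCoeff n - ((n : ℝ) + D.α + D.β + 1) * D.γ₁ n) := by
    have e : D.structCoeff n - ((n : ℝ) + D.α + D.β + 1) * D.γ₁ n =
        (((n + 1 : ℕ) : ℝ) + D.α + D.β) / (2 * (n + 1 : ℕ) + D.α + D.β) * (D.α - D.β) := by
      rw [structCoeff]
      push_cast at hp ⊢
      generalize (n : ℝ) = x at *
      generalize D.γ₁ n = γ at *
      rw [div_mul_eq_mul_div, eq_div_iff hp]
      linear_combination -hγ / 2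
    have e2 : (((n + 1 : ℕ) : ℝ) + D.α + D.β) / (2 * (n + 1 : ℕ) + D.α + D.β) *
        (2 * (n + 1 : ℕ) + D.α + D.β) = n + D.α + D.β + 1 := by
      rw [div_mul_cancel₀ _ hp]
      push_cast
      ring
    rw [cHat, e, mul_add, ← mul_assoc, ← C_mul, ← C_mul, e2]
    simp
  have hd : C (D.dHat (n + 1)) = -C (n : ℝ) - C ((n : ℝ) + D.α + D.β + 1) := by
    rw [← C_neg, ← C_sub, dHat]
    congr 1
    push_cast
    ring
  rw [hc, hd, h1, C_sub, C_mul, C_mul]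
  linear_combination -C ((n : ℝ) + D.α + D.β + 1) * h2

end Data
/-! ### Taylor polynomials -/

lemma taylorPoly_zero (y : ℝ) (f : ℝ[X]) : taylorPoly 0 y f = C (f.eval y) := by
  simp [taylorPoly]

lemma taylorPoly_succ (k : ℕ) (y : ℝ) (f : ℝ[X]) :
    taylorPoly (k + 1) y f = taylorPoly k y f +
      C ((derivative^[k + 1] f).eval y / (Nat.factorial (k + 1) : ℝ)) * (X - C y) ^ (k + 1) :=
  Finset.sum_range_succ _ _

lemma taylorPoly_add (k : ℕ) (y : ℝ) (f g : ℝ[X]) :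
    taylorPoly k y (f + g) = taylorPoly k y f + taylorPoly k y g := by
  simp only [taylorPoly, iterate_map_add, eval_add, add_div, C_add, add_mul,
    Finset.sum_add_distrib]

lemma taylorPoly_C_mul (k : ℕ) (y a : ℝ) (f : ℝ[X]) :
    taylorPoly k y (C a * f) = C a * taylorPoly k y f := by
  simp only [taylorPoly, iterate_derivative_C_mul, eval_mul, eval_C, mul_div_assoc, C_mul,
    Finset.mul_sum, mul_assoc]

lemma iterate_derivative_succ_X_mul (k : ℕ) (f : ℝ[X]) :
    derivative^[k + 1] (X * f) =
      X * derivative^[k + 1] f + ((k : ℝ[X]) + 1) * derivative^[k] f := by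
  induction k with
  | zero => simp [add_comm]
  | succ k ih =>
    have : derivative ((k : ℝ[X]) + 1) = 0 := by simp
    rw [Function.iterate_succ_apply', ih, derivative_add, derivative_mul,
      derivative_mul (f := (k : ℝ[X]) + 1), this, derivative_X,
      ← Function.iterate_succ_apply' derivative,
      ← Function.iterate_succ_apply' derivative]
    push_cast
    ring

/-- Truncation commutes with multiplication by `X` except for the one term of degree `k + 1` that it
discards. This defect is the source of the kernel term in `christoffel_step`. -/
lemma taylorPoly_X_mul (k : ℕ) (y : ℝ) (f : ℝ[X]) :
    taylorPoly k y (X * f) = X * taylorPoly k y f -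
      C ((derivative^[k] f).eval y / (Nat.factorial k : ℝ)) * (X - C y) ^ (k + 1) := by
  induction k with
  | zero => simp [taylorPoly_zero]; ring
  | succ k ih =>
    have hk : ((k : ℝ) + 1) ≠ 0 := by positivity
    have hk' : (Nat.factorial k : ℝ) ≠ 0 := by positivity
    have e : (derivative^[k + 1] (X * f)).eval y / (Nat.factorial (k + 1) : ℝ) =
        y * ((derivative^[k + 1] f).eval y / (Nat.factorial (k + 1) : ℝ)) +
          (derivative^[k] f).eval y / (Nat.factorial k : ℝ) := by
      rw [iterate_derivative_succ_X_mul, Nat.factorial_succ]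
      simp only [eval_add, eval_mul, eval_X, eval_natCast, eval_one]
      push_cast
      field_simp
    rw [taylorPoly_succ, taylorPoly_succ, ih, e, C_add, C_mul]
    ring

namespace Data

variable {D : Data}

/-! ### The Christoffel-Darboux formula -/

lemma christoffel_step (hα : -1 < D.α) (hβ : -1 < D.β) (k : ℕ) (y : ℝ) (n : ℕ) :
    D.P (n + 1) * taylorPoly k y (D.P n) - D.P n * taylorPoly k y (D.P (n + 1)) =
      C (D.γ₂z n) * (D.P n * taylorPoly k y (D.Pprev n) - D.Pprev n * taylorPoly k y (D.P n)) +
      C ((derivative^[k] (D.P n)).eval y / (Nat.factorial k : ℝ)) * (X - C y) ^ (k + 1) * D.P n := by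
  have h1 := three_term hα hβ n
  have h2 := congrArg (taylorPoly k y) h1
  simp only [taylorPoly_X_mul, taylorPoly_add, taylorPoly_C_mul] at h2
  linear_combination D.P n * h2 - taylorPoly k y (D.P n) * h1

lemma christoffel_darboux (hα : -1 < D.α) (hβ : -1 < D.β) (k : ℕ) (y : ℝ) (n : ℕ) :
    (X - C y) ^ (k + 1) *
        ∑ i ∈ Finset.range (n + 1), C ((derivative^[k] (D.P i)).eval y / D.h i) * D.P i =
      C ((Nat.factorial k : ℝ) / D.h n) *
        (D.P (n + 1) * taylorPoly k y (D.P n) - D.P n * taylorPoly k y (D.P (n + 1))) := by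
  have hk' : (Nat.factorial k : ℝ) ≠ 0 := by positivity
  have e : ∀ n, C ((derivative^[k] (D.P n)).eval y / D.h n) = C ((Nat.factorial k : ℝ) / D.h n) *
      C ((derivative^[k] (D.P n)).eval y / (Nat.factorial k : ℝ)) := by
    intro n
    rw [← C_mul]
    congr 1
    field_simp
  induction n with
  | zero =>
    rw [christoffel_step hα hβ]
    simp only [γ₂z, C_0, zero_add, Finset.sum_range_one, e]
    ring
  | succ n ih =>
    -- This ratio `h (n + 1) / h n = γ₂ (n + 1)` is what makes the sum telescope.
    have e2 : C ((Nat.factorial k : ℝ) / D.h n) =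
        C ((Nat.factorial k : ℝ) / D.h (n + 1)) * C (D.γ₂ (n + 1)) := by
      have h1 := (h_pos hα hβ n).ne'
      have h2 := (h_pos hα hβ (n + 1)).ne'
      rw [← C_mul, γ₂, Nat.add_sub_cancel]
      congr 1
      field_simp
    rw [christoffel_step hα hβ (n := n + 1), Finset.sum_range_succ, mul_add, ih, e2, e (n + 1)]
    simp only [γ₂z, Pprev]
    ring

/-! ### The Sobolev inner product -/

/-- The Jacobi-Sobolev inner product as a bilinear form. -/
def sobolevForm (hα : -1 < D.α) (hβ : -1 < D.β) : LinearMap.BilinForm ℝ ℝ[X] :=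
  LinearMap.mk₂ ℝ D.ipSobolev
    (fun f f' g => by
      simp only [ipSobolev, ipJacobi_eq hα hβ, add_mul, mul_add, map_add, iterate_map_add,
        eval_add, Finset.sum_add_distrib]
      ring)
    (fun a f g => by
      simp only [ipSobolev, ipJacobi_eq hα hβ, smul_mul_assoc, map_smul, iterate_derivative_smul,
        eval_smul, smul_eq_mul, mul_add, Finset.mul_sum]
      congr 1
      exact Finset.sum_congr rfl fun j _ => Finset.sum_congr rfl fun k _ => by ring)
    (fun f g g' => by
      simp only [ipSobolev, ipJacobi_eq hα hβ, mul_add, map_add, iterate_map_add,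
        eval_add, Finset.sum_add_distrib]
      ring)
    (fun a f g => by
      simp only [ipSobolev, ipJacobi_eq hα hβ, mul_smul_comm, map_smul, iterate_derivative_smul,
        eval_smul, smul_eq_mul, mul_add, Finset.mul_sum]
      congr 1
      exact Finset.sum_congr rfl fun j _ => Finset.sum_congr rfl fun k _ => by ring)

lemma sobolevForm_apply (hα : -1 < D.α) (hβ : -1 < D.β) (f g : ℝ[X]) :
    sobolevForm hα hβ f g = jacobiL hα hβ (f * g) +
      ∑ j : Fin D.N, ∑ k ∈ Finset.range (D.d j + 1),
        D.lam j k * (derivative^[k] f).eval (D.c j) * (derivative^[k] g).eval (D.c j) := by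
  rw [← ipJacobi_eq]
  rfl

lemma sobolevForm_pos (hα : -1 < D.α) (hβ : -1 < D.β)
    (hlam : ∀ j, ∀ k ≤ D.d j, 0 ≤ D.lam j k)
    (f : ℝ[X]) (hf : f ≠ 0) : 0 < sobolevForm hα hβ f f := by
  rw [sobolevForm_apply]
  refine add_pos_of_pos_of_nonneg (jacobiL_mul_self_pos hα hβ hf) ?_
  refine Finset.sum_nonneg fun j _ => Finset.sum_nonneg fun k hk => ?_
  rw [mul_assoc]
  exact mul_nonneg (hlam j k (Nat.lt_succ_iff.1 (Finset.mem_range.1 hk))) (mul_self_nonneg _)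

lemma S_spec (hα : -1 < D.α) (hβ : -1 < D.β)
    (hlam : ∀ j, ∀ k ≤ D.d j, 0 ≤ D.lam j k) (n : ℕ) :
    (D.S n).Monic ∧ (D.S n).natDegree = n ∧
      ∀ q : ℝ[X], q.degree < n → sobolevForm hα hβ q (D.S n) = 0 :=
  monicOrth_spec (B := sobolevForm hα hβ) (sobolevForm_pos hα hβ hlam) n

lemma S_zero (hα : -1 < D.α) (hβ : -1 < D.β)
    (hlam : ∀ j, ∀ k ≤ D.d j, 0 ≤ D.lam j k) : D.S 0 = 1 :=
  (S_spec hα hβ hlam 0).1.natDegree_eq_zero.1 (S_spec hα hβ hlam 0).2.1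

/-! ### Connection formulas between Sobolev and Jacobi polynomials -/

lemma pow_mul_ρpart (D : Data) (j : Fin D.N) {k : ℕ} (hk : k ≤ D.d j) :
    (X - C (D.c j)) ^ (k + 1) * D.ρpart j k = D.ρ := by
  rw [ρpart, ← mul_assoc, ← pow_add, show k + 1 + (D.d j - k) = D.d j + 1 by omega, ρ,
    Finset.mul_prod_erase _ (fun i => (X - C (D.c i)) ^ (D.d i + 1)) (Finset.mem_univ j)]

lemma degree_S_sub_P (hα : -1 < D.α) (hβ : -1 < D.β)
    (hlam : ∀ j, ∀ k ≤ D.d j, 0 ≤ D.lam j k) (n : ℕ) : (D.S n - D.P n).degree < n := by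
  obtain ⟨hm, hd, -⟩ := S_spec hα hβ hlam n
  have hS : (D.S n).degree = n := by rw [degree_eq_natDegree hm.ne_zero, hd]
  rw [← hS]
  exact degree_sub_lt_left (by rw [hS, P_degree hα hβ]) hm.ne_zero
    (by rw [hm.leadingCoeff, (P_monic hα hβ n).leadingCoeff])

/-- Orthogonality of `S n` to `P i` for `i < n` equates its Jacobi pairing with minus the mass
terms; interchanging the sums collects the kernels. -/
lemma S_eq (hα : -1 < D.α) (hβ : -1 < D.β)
    (hlam : ∀ j, ∀ k ≤ D.d j, 0 ≤ D.lam j k) (n : ℕ) :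
    D.S n = D.P n - ∑ j : Fin D.N, ∑ k ∈ Finset.range (D.d j + 1),
      C (D.lam j k * (derivative^[k] (D.S n)).eval (D.c j)) *
        ∑ i ∈ Finset.range n, C ((derivative^[k] (D.P i)).eval (D.c j) / D.h i) * D.P i := by
  have hexp := expansion_P hα hβ (degree_S_sub_P hα hβ hlam n)
  rw [eq_sub_iff_add_eq', ← eq_sub_iff_add_eq, ← neg_sub (D.S n), hexp]
  simp only [Finset.mul_sum]
  rw [Finset.sum_congr rfl fun j _ => Finset.sum_comm, Finset.sum_comm, ← Finset.sum_neg_distrib]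
  refine Finset.sum_congr rfl fun i hi => ?_
  have hi' := Finset.mem_range.1 hi
  have ho := (S_spec hα hβ hlam n).2.2 (D.P i) (by rw [P_degree hα hβ]; exact_mod_cast hi')
  rw [sobolevForm_apply] at ho
  rw [mul_sub, map_sub, jacobiL_P_mul_P hα hβ hi'.ne, sub_zero, eq_neg_of_add_eq_zero_left ho,
    neg_div, C_neg, neg_mul, neg_neg]
  simp only [Finset.sum_div, map_sum, Finset.sum_mul]
  refine Finset.sum_congr rfl fun j _ => Finset.sum_congr rfl fun k _ => ?_
  rw [← mul_assoc, ← C_mul]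
  congr 2
  ring

/-- `ρ S_n = A₂ P_n + B₂ P_{n-1}`. -/
lemma ρ_mul_S (hα : -1 < D.α) (hβ : -1 < D.β)
    (hlam : ∀ j, ∀ k ≤ D.d j, 0 ≤ D.lam j k)
    (n : ℕ) : D.ρ * D.S n = D.A₂ n * D.P n + D.B₂ n * D.Pprev n := by
  cases n with
  | zero => simp [A₂, B₂, Pprev, S_zero hα hβ hlam, P_zero hα hβ]
  | succ n =>
    conv_lhs => rw [S_eq hα hβ hlam (n + 1)]
    simp only [A₂, B₂, Pprev]
    rw [mul_sub, sub_mul, sub_add, sub_right_inj]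
    simp only [massSum, Finset.mul_sum (s := Finset.univ), Finset.sum_mul (s := Finset.univ),
      ← Finset.sum_sub_distrib]
    refine Finset.sum_congr rfl fun j _ => ?_
    rw [Finset.mul_sum, Finset.mul_sum, Finset.sum_mul, Finset.mul_sum, Finset.sum_mul,
      ← Finset.sum_sub_distrib]
    refine Finset.sum_congr rfl fun k hk => ?_
    have hcd := christoffel_darboux hα hβ k (D.c j) n
    -- Splitting `ρ` supplies exactly the power of `x - c_j` required by the Christoffel–Darboux
    -- formula.
    rw [← pow_mul_ρpart D j (Nat.lt_succ_iff.1 (Finset.mem_range.1 hk))]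
    rw [div_eq_mul_one_div] at hcd
    simp only [C_mul] at hcd ⊢
    linear_combination D.ρpart j k * C (D.lam j k) *
      C ((derivative^[k] (D.S (n + 1))).eval (D.c j)) *
      hcd

/-- `(1 - x²) (ρ S_n)' = A₃ P_n + B₃ P_{n-1}`. -/
lemma derivative_ρ_mul_S (hα : -1 < D.α) (hβ : -1 < D.β)
    (hlam : ∀ j, ∀ k ≤ D.d j, 0 ≤ D.lam j k) (n : ℕ) :
    (1 - X ^ 2) * derivative (D.ρ * D.S n) = D.A₃ n * D.P n + D.B₃ n * D.Pprev n := by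
  rw [ρ_mul_S hα hβ hlam]
  cases n with
  | zero => simp [A₃, B₃, A₂, B₂, Pprev, P_zero hα hβ, aHat, bHat, mul_comm]
  | succ n =>
    simp only [A₃, B₃, Pprev, derivative_add, derivative_mul]
    linear_combination D.A₂ (n + 1) * structure_raise hα hβ n +
      D.B₂ (n + 1) * structure_lower hα hβ n

lemma γ₂_mul_Pprev (hα : -1 < D.α) (hβ : -1 < D.β) (n : ℕ) :
    C (D.γ₂ (n + 1)) * D.P n = (X - C (D.γ₁ (n + 1))) * D.P (n + 1) - D.P (n + 2) := by
  have := three_term hα hβ (n + 1)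
  simp only [γ₂z, Pprev] at this
  linear_combination -this

lemma C_inv_γ₂_mul (hα : -1 < D.α) (hβ : -1 < D.β)
    (n : ℕ) : C (1 / D.γ₂ (n + 1)) * C (D.γ₂ (n + 1)) = 1 := by
  have h : D.γ₂ (n + 1) ≠ 0 := (div_pos (h_pos hα hβ (n + 1)) (h_pos hα hβ n)).ne'
  rw [← C_mul, one_div_mul_cancel h, C_1]

lemma P_one (hα : -1 < D.α) (hβ : -1 < D.β) : D.P 1 = X - C (D.γ₁ 0) := by
  have := three_term hα hβ 0
  simp only [γ₂z, Pprev, P_zero hα hβ, C_0] at this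
  linear_combination -this

/-- `ρ S_{n-1} = C₂ P_n + D₂ P_{n-1}`. -/
lemma ρ_mul_S_pred (hα : -1 < D.α) (hβ : -1 < D.β)
    (hlam : ∀ j, ∀ k ≤ D.d j, 0 ≤ D.lam j k) (n : ℕ) :
    D.ρ * D.S n = D.C₂ (n + 1) * D.P (n + 1) + D.D₂ (n + 1) * D.P n := by
  rw [ρ_mul_S hα hβ hlam]
  cases n with
  | zero =>
    -- As `P_0 = 1` and `P_1 = x - γ₁ 0`, the identity holds for any value of `C₂ 1`; that value
    -- matters only for `q₄ 1 ≠ 0`. The same is true of `C₃ 1`.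
    simp only [D₂, Pprev, P_one hα hβ, P_zero hα hβ]
    ring
  | succ n =>
    simp only [D₂, C₂, Pprev]
    linear_combination (C (1 / D.γ₂ (n + 1)) * D.B₂ (n + 1)) * γ₂_mul_Pprev hα hβ n -
      D.B₂ (n + 1) * D.P n * C_inv_γ₂_mul hα hβ n

/-- `(1 - x²) (ρ S_{n-1})' = C₃ P_n + D₃ P_{n-1}`. -/
lemma derivative_ρ_mul_S_pred (hα : -1 < D.α) (hβ : -1 < D.β)
    (hlam : ∀ j, ∀ k ≤ D.d j, 0 ≤ D.lam j k) (n : ℕ) :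
    (1 - X ^ 2) * derivative (D.ρ * D.S n) =
      D.C₃ (n + 1) * D.P (n + 1) + D.D₃ (n + 1) * D.P n := by
  rw [derivative_ρ_mul_S hα hβ hlam]
  cases n with
  | zero =>
    simp only [D₃, Pprev, P_one hα hβ, P_zero hα hβ]
    ring
  | succ n =>
    simp only [D₃, C₃, Pprev]
    linear_combination (C (1 / D.γ₂ (n + 1)) * D.B₃ (n + 1)) * γ₂_mul_Pprev hα hβ n -
      D.B₃ (n + 1) * D.P n * C_inv_γ₂_mul hα hβ n

/-! ### The raising identity -/

/-- Cramer's rule: `P_{n+1}` and `P_n` are eliminated from the three connection formulas. -/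
lemma raising_identity (hα : -1 < D.α) (hβ : -1 < D.β)
    (hlam : ∀ j, ∀ k ≤ D.d j, 0 ≤ D.lam j k) (n : ℕ) :
    D.ρ * (D.C₃ (n + 1) * D.D₂ (n + 1) - D.D₃ (n + 1) * D.C₂ (n + 1)) * D.S (n + 1) =
      (1 - X ^ 2) * derivative (D.ρ * D.S n) * D.Δ (n + 1) +
        D.ρ * (D.C₃ (n + 1) * D.B₂ (n + 1) - D.D₃ (n + 1) * D.A₂ (n + 1)) * D.S n := by
  have h1 := ρ_mul_S hα hβ hlam (n + 1)
  have h2 := ρ_mul_S_pred hα hβ hlam n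
  have h3 := derivative_ρ_mul_S_pred hα hβ hlam n
  simp only [Pprev] at h1
  rw [h3, Δ]
  linear_combination (D.C₃ (n + 1) * D.D₂ (n + 1) - D.D₃ (n + 1) * D.C₂ (n + 1)) * h1 -
    (D.C₃ (n + 1) * D.B₂ (n + 1) - D.D₃ (n + 1) * D.A₂ (n + 1)) * h2

lemma ρ_ne_zero (D : Data) : D.ρ ≠ 0 :=
  (monic_prod_of_monic _ _ fun j _ => (monic_X_sub_C (D.c j)).pow _).ne_zero

lemma ratDeriv_algebraMap (p : ℝ[X]) :
    ratDeriv (algebraMap ℝ[X] (RatFunc ℝ) p) = algebraMap ℝ[X] (RatFunc ℝ) (derivative p) := by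
  simp [ratDeriv]

lemma raising_S (hα : -1 < D.α) (hβ : -1 < D.β)
    (hlam : ∀ j, ∀ k ≤ D.d j, 0 ≤ D.lam j k) (n : ℕ)
    (hq : D.C₃ (n + 1) * D.D₂ (n + 1) - D.D₃ (n + 1) * D.C₂ (n + 1) ≠ 0) :
    D.raising (n + 1) (algebraMap ℝ[X] (RatFunc ℝ) (D.S n)) =
      algebraMap ℝ[X] (RatFunc ℝ) (D.S (n + 1)) := by
  have h1 := congrArg (algebraMap ℝ[X] (RatFunc ℝ)) (raising_identity hα hβ hlam n)
  have hq' := RatFunc.algebraMap_ne_zero hq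
  have hρ := RatFunc.algebraMap_ne_zero (ρ_ne_zero D)
  rw [raising, ratDeriv_algebraMap, div_mul_eq_mul_div, div_mul_eq_mul_div, ← add_div,
    q₄, div_eq_iff hq', q₃, q₀, δ]
  refine mul_left_cancel₀ hρ ?_
  rw [derivative_mul] at h1
  simp only [map_mul, map_add] at h1 ⊢
  field_simp
  linear_combination -h1

/-! ### The determinant in the denominator does not vanish -/

lemma natDegree_one_sub_sq_mul_derivative_le {f : ℝ[X]} {n : ℕ} (hf : f.natDegree ≤ n) :
    ((1 - X ^ 2) * derivative f).natDegree ≤ n + 1 := by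
  refine natDegree_le_iff_coeff_eq_zero.2 fun m hm => ?_
  rw [coeff_one_sub_sq_mul_derivative hf (by omega), if_neg (by omega)]

/-- Both products have degree at most `2d`, so only top coefficients contribute and `e` drops out.
Writing `(X * B).coeff d` for the coefficient of `B` in degree `d - 1` also covers `d = 0`, where `B
= 0`. -/
lemma coeff_wronskian {A B a c : ℝ[X]} {d : ℕ} (hA : A.natDegree ≤ d) (hA1 : A.coeff d = 1)
    (hB : B.degree < d) (ha : a.natDegree ≤ 1) (hc : c.natDegree ≤ 1) (e b : ℝ) :
    ((derivative A * (1 - X ^ 2) + a * A + C e * B) * B -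
      (derivative B * (1 - X ^ 2) + C b * A + c * B) * A).coeff (d + d) =
      (a.coeff 1 - c.coeff 1 - 1) * (X * B).coeff d - b := by
  rw [mul_comm (derivative A), mul_comm (derivative B)]
  rcases d with _ | d
  · obtain rfl : B = 0 := by simpa using hB
    simp [mul_coeff_zero, hA1]
  have hB' : B.natDegree ≤ d := by
    refine natDegree_le_iff_coeff_eq_zero.2 fun m hm => coeff_eq_zero_of_degree_lt ?_
    exact hB.trans_le (by exact_mod_cast hm)
  have hA3 : ((1 - X ^ 2) * derivative A + a * A + C e * B).natDegree ≤ d + 2 := by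
    refine natDegree_add_le_of_degree_le (natDegree_add_le_of_degree_le
      (natDegree_one_sub_sq_mul_derivative_le hA) ?_) ?_
    · exact (natDegree_mul_le_of_le ha hA).trans (by omega)
    · exact (natDegree_C_mul_le _ _).trans (hB'.trans (by omega))
  have hB3 : ((1 - X ^ 2) * derivative B + C b * A + c * B).natDegree ≤ d + 1 := by
    refine natDegree_add_le_of_degree_le (natDegree_add_le_of_degree_le
      (natDegree_one_sub_sq_mul_derivative_le hB') ?_) ?_
    · exact (natDegree_C_mul_le _ _).trans hA
    · exact (natDegree_mul_le_of_le hc hB').trans (by omega)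
  have hA3c : ((1 - X ^ 2) * derivative A + a * A + C e * B).coeff (d + 2) =
      a.coeff 1 - (d + 1) := by
    rw [coeff_add, coeff_add, coeff_one_sub_sq_mul_derivative hA (by omega), if_pos rfl, coeff_C_mul,
      coeff_eq_zero_of_natDegree_lt (show B.natDegree < d + 2 by omega), hA1,
      show d + 2 = 1 + (d + 1) by omega, coeff_mul_add_eq_of_natDegree_le ha hA, hA1]
    push_cast
    ring
  have hB3c : ((1 - X ^ 2) * derivative B + C b * A + c * B).coeff (d + 1) =
      b + (c.coeff 1 - d) * B.coeff d := by
    rw [coeff_add, coeff_add, coeff_one_sub_sq_mul_derivative hB' (by omega), if_pos rfl,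
      coeff_C_mul, hA1, add_comm d 1, coeff_mul_add_eq_of_natDegree_le hc hB']
    ring
  rw [coeff_sub, coeff_mul_add_eq_of_natDegree_le hB3 hA, hB3c, hA1, coeff_X_mul,
    show d + 1 + (d + 1) = d + 2 + d by omega, coeff_mul_add_eq_of_natDegree_le hA3 hB', hA3c]
  ring

/-! ### Degrees and leading coefficients of the mass sums -/

lemma ρ_monic (D : Data) : D.ρ.Monic :=
  monic_prod_of_monic _ _ fun j _ => (monic_X_sub_C (D.c j)).pow _

lemma ρpart_monic (D : Data) (j : Fin D.N) (k : ℕ) : (D.ρpart j k).Monic :=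
  ((monic_X_sub_C (D.c j)).pow _).mul
    (monic_prod_of_monic _ _ fun i _ => (monic_X_sub_C (D.c i)).pow _)

lemma natDegree_ρ_eq (D : Data) (j : Fin D.N) {k : ℕ} (hk : k ≤ D.d j) :
    D.ρ.natDegree = k + (D.ρpart j k).natDegree + 1 := by
  rw [← pow_mul_ρpart D j hk, ((monic_X_sub_C (D.c j)).pow _).natDegree_mul (ρpart_monic D j k),
    natDegree_pow, natDegree_X_sub_C]
  ring

lemma natDegree_taylorPoly_le (k : ℕ) (y : ℝ) (f : ℝ[X]) : (taylorPoly k y f).natDegree ≤ k := by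
  refine natDegree_sum_le_of_forall_le _ _ fun ν hν => (natDegree_C_mul_le _ _).trans ?_
  rw [natDegree_pow, natDegree_X_sub_C, mul_one]
  exact Nat.lt_succ_iff.1 (Finset.mem_range.1 hν)

lemma coeff_taylorPoly (k : ℕ) (y : ℝ) (f : ℝ[X]) :
    (taylorPoly k y f).coeff k = (derivative^[k] f).eval y / (Nat.factorial k : ℝ) := by
  have hm : ((X - C y) ^ k).coeff k = 1 := by
    simpa using ((monic_X_sub_C y).pow k).coeff_natDegree
  cases k with
  | zero => simp [taylorPoly_zero]
  | succ k =>
    rw [taylorPoly_succ, coeff_add, coeff_C_mul, hm, mul_one,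
      coeff_eq_zero_of_natDegree_lt ((natDegree_taylorPoly_le k y f).trans_lt k.lt_succ_self),
      zero_add]

lemma degree_massSum_lt (D : Data) (n : ℕ) (f : ℝ[X]) :
    (D.massSum n f).degree < D.ρ.natDegree := by
  rw [← mem_degreeLT]
  refine Submodule.sum_mem _ fun j _ => Submodule.sum_mem _ fun k hk => ?_
  rw [mem_degreeLT, natDegree_ρ_eq D j (Nat.lt_succ_iff.1 (Finset.mem_range.1 hk))]
  refine lt_of_le_of_lt degree_le_natDegree ?_
  have h1 := natDegree_mul_le_of_le ((natDegree_C_mul_le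
    ((Nat.factorial k : ℝ) * D.lam j k * (derivative^[k] (D.S n)).eval (D.c j)) _).trans
    (natDegree_taylorPoly_le k (D.c j) f)) (le_refl (D.ρpart j k).natDegree)
  exact_mod_cast Nat.lt_succ_of_le h1

/-- The factor `k!` cancels the one in the top Taylor coefficient, leaving the discrete part of the
Sobolev product of `f` and `S n`. -/
lemma coeff_massSum (D : Data) (n : ℕ) (f : ℝ[X]) :
    (X * D.massSum n f).coeff D.ρ.natDegree =
      ∑ j : Fin D.N, ∑ k ∈ Finset.range (D.d j + 1),
        D.lam j k * (derivative^[k] f).eval (D.c j) * (derivative^[k] (D.S n)).eval (D.c j) := by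
  simp only [massSum, Finset.mul_sum, finsetSum_coeff]
  refine Finset.sum_congr rfl fun j _ => Finset.sum_congr rfl fun k hk => ?_
  have hk' : (Nat.factorial k : ℝ) ≠ 0 := by positivity
  rw [natDegree_ρ_eq D j (Nat.lt_succ_iff.1 (Finset.mem_range.1 hk)), coeff_X_mul, mul_assoc,
    coeff_C_mul, coeff_mul_add_eq_of_natDegree_le (natDegree_taylorPoly_le _ _ _) le_rfl,
    coeff_taylorPoly, (ρpart_monic D j k).coeff_natDegree]
  field_simp

/-- The Sobolev products of `P n` and of `S n` with `S n` agree, and the integral part of the former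
is `h n`. -/
lemma coeff_massSum_P (hα : -1 < D.α) (hβ : -1 < D.β)
    (hlam : ∀ j, ∀ k ≤ D.d j, 0 ≤ D.lam j k) (n : ℕ) :
    (X * D.massSum n (D.P n)).coeff D.ρ.natDegree =
      sobolevForm hα hβ (D.S n) (D.S n) - D.h n := by
  obtain ⟨hm, hd, ho⟩ := S_spec hα hβ hlam n
  have h1 := ho _ (degree_S_sub_P hα hβ hlam n)
  rw [map_sub, LinearMap.sub_apply, sub_eq_zero] at h1
  have hS : (D.S n).coeff n = 1 := by
    have := hm.coeff_natDegree
    rwa [hd] at this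
  have hSd : (D.S n).degree < (n + 1 : ℕ) := by
    rw [degree_eq_natDegree hm.ne_zero, hd]
    exact_mod_cast n.lt_succ_self
  rw [h1, sobolevForm_apply, mul_comm (D.P n), jacobiL_mul_P hα hβ hSd, hS, coeff_massSum]
  ring

lemma aHat_spec (n : ℕ) (hn : (2 * n + D.α + D.β ≠ 0) ∨ n = 0) :
    (D.aHat n).natDegree ≤ 1 ∧ (D.aHat n).coeff 1 = -n := by
  have e : D.aHat n = C (-((n : ℝ) / (2 * n + D.α + D.β) * (2 * n + D.α + D.β))) * X +
      C (-((n : ℝ) / (2 * n + D.α + D.β) * (D.β - D.α))) := by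
    simp only [aHat, C_neg, C_mul]
    ring
  rw [e]
  refine ⟨natDegree_linear_le, ?_⟩
  rcases hn with hn | rfl
  · simp [div_mul_cancel₀ _ hn]
  · simp

lemma cHat_spec (hα : -1 < D.α) (hβ : -1 < D.β) (n : ℕ) :
    (D.cHat n).natDegree ≤ 1 ∧ (D.cHat n).coeff 1 = n + D.α + D.β := by
  cases n with
  | zero =>
    refine ⟨natDegree_linear_le, ?_⟩
    simp [cHat, coeff_C]
  | succ n =>
    have hp : 2 * ((n + 1 : ℕ) : ℝ) + D.α + D.β ≠ 0 := by
      have hx : (0 : ℝ) ≤ n := n.cast_nonneg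
      push_cast
      intro h
      linarith [hα, hβ]
    have e : D.cHat (n + 1) = C (((n + 1 : ℕ) : ℝ) + D.α + D.β) * X +
        C ((((n + 1 : ℕ) : ℝ) + D.α + D.β) / (2 * (n + 1 : ℕ) + D.α + D.β) * (D.α - D.β)) := by
      rw [cHat, mul_add, ← mul_assoc, ← C_mul, ← C_mul, div_mul_cancel₀ _ hp]
      exact n.succ_ne_zero
    rw [e]
    refine ⟨natDegree_linear_le, ?_⟩
    rw [coeff_add, coeff_C_mul, coeff_X_one, coeff_C_of_ne_zero one_ne_zero, mul_one, add_zero]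

lemma degree_C_mul_massSum_lt (D : Data) (a : ℝ) (n : ℕ) (f : ℝ[X]) :
    (C a * D.massSum n f).degree < D.ρ.natDegree := by
  rw [← smul_eq_C_mul]
  exact (degree_smul_le _ _).trans_lt (degree_massSum_lt D n f)

lemma coeff_X_mul_C_mul (a : ℝ) (f : ℝ[X]) (d : ℕ) :
    (X * (C a * f)).coeff d = a * (X * f).coeff d := by
  rw [mul_left_comm, coeff_C_mul]

lemma A₂_spec (D : Data) (n : ℕ) :
    (D.A₂ n).natDegree ≤ D.ρ.natDegree ∧ (D.A₂ n).coeff D.ρ.natDegree = 1 := by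
  cases n with
  | zero => exact ⟨le_rfl, (ρ_monic D).coeff_natDegree⟩
  | succ n =>
    have h := degree_C_mul_massSum_lt D (1 / D.h n) (n + 1) (D.P n)
    refine ⟨?_, ?_⟩
    · exact (natDegree_sub_le_of_le le_rfl (natDegree_le_of_degree_le h.le)).trans (max_self _).le
    · rw [A₂, coeff_sub, coeff_eq_zero_of_degree_lt h, (ρ_monic D).coeff_natDegree, sub_zero]

lemma two_mul_add_pos (hα : -1 < D.α) (hβ : -1 < D.β)
    (n : ℕ) : 0 < 2 * ((n + 1 : ℕ) : ℝ) + D.α + D.β := by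
  have hx : (0 : ℝ) ≤ n := n.cast_nonneg
  push_cast
  linarith [hα, hβ]

/-- In the coefficient of degree `2 deg ρ` the contribution of `bHat` cancels the `-h` of
`coeff_massSum_P`, leaving a nonzero multiple of the Sobolev norm. -/
lemma A₃_mul_B₂_sub_ne_zero (hα : -1 < D.α) (hβ : -1 < D.β)
    (hlam : ∀ j, ∀ k ≤ D.d j, 0 ≤ D.lam j k) (n : ℕ) :
    D.A₃ (n + 1) * D.B₂ (n + 1) - D.B₃ (n + 1) * D.A₂ (n + 1) ≠ 0 := by
  intro h
  have hp := two_mul_add_pos hα hβ n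
  have hB : (D.B₂ (n + 1)).degree < D.ρ.natDegree := degree_C_mul_massSum_lt D _ _ _
  obtain ⟨ha, ha1⟩ := aHat_spec (n + 1) (Or.inl hp.ne')
  obtain ⟨hc, hc1⟩ := cHat_spec hα hβ (n + 1)
  have hW := coeff_wronskian (A₂_spec D (n + 1)).1 (A₂_spec D (n + 1)).2 hB ha hc
    (D.dHat (n + 1)) (D.bHat (n + 1))
  rw [A₃, B₃] at h
  rw [h, coeff_zero, ha1, hc1, B₂, coeff_X_mul_C_mul, coeff_massSum_P hα hβ hlam,
    bHat_eq hα hβ, γ₂z, γ₂, Nat.add_sub_cancel] at hW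
  have hpos := sobolevForm_pos hα hβ hlam (D.S (n + 1)) (S_spec hα hβ hlam (n + 1)).1.ne_zero
  have hh := h_pos hα hβ n
  have : (2 * ((n + 1 : ℕ) : ℝ) + D.α + D.β + 1) *
      (sobolevForm hα hβ (D.S (n + 1)) (D.S (n + 1)) / D.h n) = 0 := by
    rw [sub_eq_add_neg, sub_eq_add_neg] at hW
    linear_combination hW
  exact absurd this (mul_pos (by linarith) (div_pos hpos hh)).ne'

lemma massSum_zero (hα : -1 < D.α) (hβ : -1 < D.β)
    (hlam : ∀ j, ∀ k ≤ D.d j, 0 ≤ D.lam j k)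
    : D.massSum 0 (D.P 0) = ∑ j : Fin D.N, C (D.lam j 0) * D.ρpart j 0 := by
  rw [massSum, S_zero hα hβ hlam, P_zero hα hβ]
  refine Finset.sum_congr rfl fun j _ => ?_
  rw [Finset.sum_eq_single 0]
  · simp [taylorPoly_zero]
  · intro k _ hk
    obtain ⟨k, rfl⟩ := Nat.exists_eq_succ_of_ne_zero hk
    simp
  · simp

/-- The Wronskian of `ρ` and `∑ j, w j * ρ / (x - c_j)`. -/
lemma wronskian_ρ (D : Data) (w : Fin D.N → ℝ) :
    derivative D.ρ * (∑ j, C (w j) * D.ρpart j 0) -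
      derivative (∑ j, C (w j) * D.ρpart j 0) * D.ρ = ∑ j, C (w j) * D.ρpart j 0 ^ 2 := by
  rw [derivative_sum, Finset.mul_sum, Finset.sum_mul, ← Finset.sum_sub_distrib]
  refine Finset.sum_congr rfl fun j _ => ?_
  rw [← pow_mul_ρpart D j (Nat.zero_le _)]
  simp only [zero_add, pow_one, derivative_mul, derivative_sub, derivative_X, derivative_C]
  ring

lemma eval_ρpart_ne_zero (hc : ∀ j, D.c j ∉ Set.Ioo (-1 : ℝ) 1) {x : ℝ}
    (hx : x ∈ Set.Ioo (-1 : ℝ) 1) (j : Fin D.N) : (D.ρpart j 0).eval x ≠ 0 := by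
  have h : D.ρ.eval x ≠ 0 := by
    rw [ρ, eval_prod]
    refine Finset.prod_ne_zero_iff.2 fun i _ => ?_
    rw [eval_pow, eval_sub, eval_X, eval_C]
    exact pow_ne_zero _ (sub_ne_zero.2 fun e => hc i (e ▸ hx))
  rw [← pow_mul_ρpart D j (Nat.zero_le _), eval_mul] at h
  exact right_ne_zero_of_mul h

/-- Without `hdeg` both `C₂ 1` and `C₃ 1` would be zero, and with them `q₄ 1`. -/
lemma C₃_one_mul_sub_ne_zero (hα : -1 < D.α) (hβ : -1 < D.β)
    (hlam : ∀ j, ∀ k ≤ D.d j, 0 ≤ D.lam j k) (hc : ∀ j, D.c j ∉ Set.Ioo (-1 : ℝ) 1)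
    (hdeg : D.α + D.β ≠ -1 ∨ ∃ j, 0 < D.lam j 0) :
    D.C₃ 1 * D.A₂ 0 - D.A₃ 0 * D.C₂ 1 ≠ 0 := by
  intro h
  have hh := h_pos hα hβ 0
  by_cases hs : D.α + D.β = -1
  · obtain ⟨j₀, hj₀⟩ := hdeg.resolve_left (not_not.2 hs)
    -- At this point `cHat 0 = -x + α - β` vanishes, so only `1 - x²` times a Wronskian of `ρ` and
    -- the mass sum survives; no `c j` lies in the open interval, so the squares in it are positive.
    have hx : D.α - D.β ∈ Set.Ioo (-1 : ℝ) 1 := ⟨by linarith, by linarith⟩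
    have hw := congrArg (eval (D.α - D.β)) (wronskian_ρ D fun j => D.lam j 0)
    rw [← massSum_zero hα hβ hlam] at hw
    have h' := congrArg (eval (D.α - D.β)) h
    have ha : D.aHat 0 = 0 := by simp [aHat]
    simp only [C₃, A₃, A₂, C₂, B₂, cHat, ha, hs, eval_sub, eval_mul, eval_add, eval_neg, eval_C,
      eval_X, eval_one, eval_pow, eval_zero, derivative_neg, derivative_mul, derivative_C,
      eval_finsetSum] at h' hw
    have hpos : 0 < ∑ j, D.lam j 0 * (D.ρpart j 0).eval (D.α - D.β) ^ 2 := by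
      refine Finset.sum_pos' (fun j _ => mul_nonneg (hlam j 0 (Nat.zero_le _)) (sq_nonneg _))
        ⟨j₀, Finset.mem_univ _, mul_pos hj₀ ?_⟩
      exact sq_pos_of_ne_zero (eval_ρpart_ne_zero hc hx j₀)
    rw [← hw] at hpos
    have h1 : 0 < 1 - (D.α - D.β) ^ 2 := by nlinarith [hx.1, hx.2]
    have := mul_pos (mul_pos h1 (one_div_pos.2 hh)) hpos
    refine this.ne' ?_
    linear_combination h'
  · have hB : (D.C₂ 1).degree < D.ρ.natDegree := by
      rw [C₂, degree_neg]
      exact degree_C_mul_massSum_lt D _ _ _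
    obtain ⟨hc, hc1⟩ := cHat_spec hα hβ 0
    obtain ⟨ha, ha1⟩ := aHat_spec 0 (Or.inr rfl)
    -- `C₂ 1` plays the role of `B₂`, and `-(α + β + 1)` that of `bHat`; `e = 0` because `B₂ 0 = 0`.
    have hW := coeff_wronskian (A₂_spec D 0).1 (A₂_spec D 0).2 hB ha hc 0 (-(D.α + D.β + 1))
    have h' : (derivative (D.A₂ 0) * (1 - X ^ 2) + D.aHat 0 * D.A₂ 0 + C 0 * D.C₂ 1) * D.C₂ 1 -
        (derivative (D.C₂ 1) * (1 - X ^ 2) + C (-(D.α + D.β + 1)) * D.A₂ 0 +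
          D.cHat 0 * D.C₂ 1) * D.A₂ 0 = 0 := by
      rw [← neg_eq_zero, ← h, C₃, A₃, B₂, C_neg, C_0]
      ring
    have e : (X * D.C₂ 1).coeff D.ρ.natDegree =
        -(1 / D.h 0 * (sobolevForm hα hβ (D.S 0) (D.S 0) - D.h 0)) := by
      rw [C₂, mul_neg, coeff_neg, coeff_X_mul_C_mul, coeff_massSum_P hα hβ hlam]
    rw [h', coeff_zero, ha1, hc1, e] at hW
    have hpos := sobolevForm_pos hα hβ hlam (D.S 0) (S_spec hα hβ hlam 0).1.ne_zero
    have : (D.α + D.β + 1) * (sobolevForm hα hβ (D.S 0) (D.S 0) / D.h 0) = 0 := by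
      field_simp at hW ⊢
      push_cast at hW
      linear_combination -hW
    rcases mul_eq_zero.1 this with h0 | h0
    · exact hs (by linarith)
    · exact (div_pos hpos hh).ne' h0

lemma q₄_ne_zero (hα : -1 < D.α) (hβ : -1 < D.β)
    (hlam : ∀ j, ∀ k ≤ D.d j, 0 ≤ D.lam j k) (hc : ∀ j, D.c j ∉ Set.Ioo (-1 : ℝ) 1)
    (hdeg : D.α + D.β ≠ -1 ∨ ∃ j, 0 < D.lam j 0) (n : ℕ) :
    D.C₃ (n + 1) * D.D₂ (n + 1) - D.D₃ (n + 1) * D.C₂ (n + 1) ≠ 0 := by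
  -- A column operation: the terms with `x - γ₁` in `D₂` and `D₃` cancel in the determinant.
  have e : D.C₃ (n + 1) * D.D₂ (n + 1) - D.D₃ (n + 1) * D.C₂ (n + 1) =
      D.C₃ (n + 1) * D.A₂ n - D.A₃ n * D.C₂ (n + 1) := by
    rw [D₂, D₃]
    ring
  rw [e]
  cases n with
  | zero => exact C₃_one_mul_sub_ne_zero hα hβ hlam hc hdeg
  | succ n =>
    intro h
    refine A₃_mul_B₂_sub_ne_zero hα hβ hlam n ?_
    rw [C₃, C₂] at h
    linear_combination C (D.γ₂ (n + 1)) * h - (D.A₃ (n + 1) * D.B₂ (n + 1) -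
      D.B₃ (n + 1) * D.A₂ (n + 1)) * C_inv_γ₂_mul hα hβ n

end Data
end JacobiSobolev
end

theorem mainTheorem5 (D : JacobiSobolev.Data)
    (hα : -1 < D.α) (hβ : -1 < D.β)
    (hc_inj : Function.Injective D.c)
    (hc : ∀ j, D.c j ∉ Set.Ioo (-1 : ℝ) 1)
    (hlam : ∀ j, ∀ k ≤ D.d j, 0 ≤ D.lam j k)
    (hlam_top : ∀ j, 0 < D.lam j (D.d j))
    (hdeg : D.α + D.β ≠ -1 ∨ ∃ j, 0 < D.lam j 0) :
    D.S 0 = 1 ∧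
      ∀ n : ℕ, algebraMap (Polynomial ℝ) (RatFunc ℝ) (D.S n) =
        D.raisingComp n (algebraMap (Polynomial ℝ) (RatFunc ℝ) (D.S 0)) := by
  refine ⟨JacobiSobolev.Data.S_zero hα hβ hlam, fun n => ?_⟩
  induction n with
  | zero => rfl
  | succ n ih =>
    rw [JacobiSobolev.Data.raisingComp, Function.comp_apply, ← ih,
      JacobiSobolev.Data.raising_S hα hβ hlam n
        (JacobiSobolev.Data.q₄_ne_zero hα hβ hlam hc hdeg n)]
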